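/- Notation. For $X,Y\in\mathbb C^{k\times l}$ let $\Delta(X,Y)=\begin{pmatrix}X&Y\\ \overline Y&\overline X\end{pmatrix}$, let $J_k=\begin{pmatrix}\mathbb 1_k&0\\0&-\mathbb 1_k\end{pmatrix}$, and for $Z\in\mathbb C^{2k\times 2l}$ let $Z^\flat=J_lZ^\dagger J_k$. A matrix $T\in\mathbb C^{2n\times 2n}$ is symplectic if $T^\flat T=TT^\flat=\mathbb 1$ and $T=\Delta(T_-,T_+)$ for some $T_\pm\in\mathbb C^{n\times n}$. A quantum linear system (QLS) $(C,\Omega)$ with $n$ modes and $m$ input channels is given by $C=\Delta(C_-,C_+)$ and $\Omega=\Delta(\Omega_-,\Omega_+)$ with $C_\pm\in\mathbb C^{m\times n}$, $\Omega_\pm\in\mathbb C^{n\times n}$, $\Omega_-=\Omega_-^\dagger$, $\Omega_+=\Omega_+^T$. Put $A=-\tfrac12C^\flat C-iJ_n\Omega$; the system is (Hurwitz) stable if all eigenvalues of $A$ have negative real part. Its transfer function is $\Xi(s)=\mathbb 1-C(s-A)^{-1}C^\flat$, and its power spectrum for vacuum input is $\Psi(s)=\Xi(s)V_{\mathrm{vac}}\Xi(-\bar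 s)^\dagger$ with $V_{\mathrm{vac}}=\begin{pmatrix}\mathbb 1_m&0\\0&0\end{pmatrix}$; both are rational functions of $s$, and equality "for all $s$" means equality at every $s$ at which the defining formulas of both sides make sense (equivalently, equality as rational functions). A QLS is globally minimal (for vacuum input) if no stable QLS with the same number of channels and strictly fewer modes has the same power spectrum. Theorem. Let $(C_1,\Omega_1)$ and $(C_2,\Omega_2)$ be two stable QLSs with the same number $m$ of channels, with $n_1$ and $n_2$ modes, both globally minimal for the input $V_{\mathrm{vac}}$. Then $$\Psi_1(s)=\Psi_2(s)\ \text{ for all } s\quad\Longleftrightarrow\quad \Xi_1(s)=\Xi_2(s)\ \text{ for all } s .$$ Moreover, each of these two conditions holds if and only if $n_1=n_2$ and there is a symplectic matrix $T$ with $A_2=TA_1T^\flat$ and $C_2=C_1T^\flat$. -/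

import Mathlib

open Matrix

noncomputable section

/-- Doubled-up index set: `k` annihilation-type and `k` creation-type indices. -/
abbrev Dbl (k : ℕ) : Type := Fin k ⊕ Fin k

/-- The doubled-up matrix `Δ(X, Y) = [X, Y; conj Y, conj X]`. -/
def doubledUp {k l : ℕ} (X Y : Matrix (Fin k) (Fin l) ℂ) : Matrix (Dbl k) (Dbl l) ℂ :=
  Matrix.fromBlocks X Y (Y.map (starRingEnd ℂ)) (X.map (starRingEnd ℂ))

/-- `J_k = [1, 0; 0, -1]`. -/
def matJ (k : ℕ) : Matrix (Dbl k) (Dbl k) ℂ :=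
  Matrix.fromBlocks 1 0 0 (-1)

/-- `Z^♭ = J Z† J`. -/
def flat {k l : ℕ} (Z : Matrix (Dbl k) (Dbl l) ℂ) : Matrix (Dbl l) (Dbl k) ℂ :=
  matJ l * Zᴴ * matJ k

/-- Symplectic matrices: `♭`-unitary and doubled-up. The two unitarity equations force `k = l`;
distinct names for the two sizes only avoid a cast between `Fin k` and `Fin l`. -/
def IsSymplectic {k l : ℕ} (T : Matrix (Dbl k) (Dbl l) ℂ) : Prop :=
  flat T * T = 1 ∧ T * flat T = 1 ∧ ∃ X Y : Matrix (Fin k) (Fin l) ℂ, T = doubledUp X Y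

/-- A quantum linear system with `n` modes and `m` input channels, given by its coupling
matrices `C₋, C₊` and its Hamiltonian matrices `Ω₋ = Ω₋†`, `Ω₊ = Ω₊ᵀ`. -/
structure QLS (n m : ℕ) where
  Cminus : Matrix (Fin m) (Fin n) ℂ
  Cplus : Matrix (Fin m) (Fin n) ℂ
  Omegaminus : Matrix (Fin n) (Fin n) ℂ
  Omegaplus : Matrix (Fin n) (Fin n) ℂ
  conjTranspose_Omegaminus : Omegaminusᴴ = Omegaminus
  transpose_Omegaplus : Omegaplusᵀ = Omegaplus

namespace QLS

/-- `C = Δ(C₋, C₊)`. -/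
def C {n m : ℕ} (G : QLS n m) : Matrix (Dbl m) (Dbl n) ℂ :=
  doubledUp G.Cminus G.Cplus

/-- `Ω = Δ(Ω₋, Ω₊)`. -/
def Omega {n m : ℕ} (G : QLS n m) : Matrix (Dbl n) (Dbl n) ℂ :=
  doubledUp G.Omegaminus G.Omegaplus

/-- `A = -½ C^♭ C - i J Ω`. -/
def A {n m : ℕ} (G : QLS n m) : Matrix (Dbl n) (Dbl n) ℂ :=
  -((1 / 2 : ℂ) • (flat G.C * G.C)) - Complex.I • (matJ n * G.Omega)

/-- Hurwitz stability: every eigenvalue of `A` has negative real part. -/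
def IsHurwitz {n m : ℕ} (G : QLS n m) : Prop :=
  ∀ μ ∈ spectrum ℂ G.A, μ.re < 0

/-- The transfer function `Ξ(s) = 1 - C (s - A)⁻¹ C^♭`, meaningful for `s ∉ spectrum ℂ A`. -/
def transferFunction {n m : ℕ} (G : QLS n m) (s : ℂ) : Matrix (Dbl m) (Dbl m) ℂ :=
  1 - G.C * (s • (1 : Matrix (Dbl n) (Dbl n) ℂ) - G.A)⁻¹ * flat G.C

/-- The power spectrum `Ψ_V(s) = Ξ(s) V Ξ(-conj s)†` for the input covariance `V`, meaningful
when neither `s` nor `-conj s` is an eigenvalue of `A`. -/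
def powerSpectrum {n m : ℕ} (G : QLS n m) (V : Matrix (Dbl m) (Dbl m) ℂ) (s : ℂ) :
    Matrix (Dbl m) (Dbl m) ℂ :=
  G.transferFunction s * V * (G.transferFunction (-(starRingEnd ℂ s)))ᴴ

/-- Equality of the rational functions `Ξ₁` and `Ξ₂`: they agree at every `s` at which both
defining formulas make sense (all but finitely many `s`). -/
def SameTransferFunction {n₁ n₂ m : ℕ} (G₁ : QLS n₁ m) (G₂ : QLS n₂ m) : Prop :=
  ∀ s : ℂ, s ∉ spectrum ℂ G₁.A → s ∉ spectrum ℂ G₂.A →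
    G₁.transferFunction s = G₂.transferFunction s

/-- Equality of the rational functions `Ψ₁` and `Ψ₂` for the input covariance `V`: they agree at
every `s` at which both defining formulas make sense (all but finitely many `s`). -/
def SamePowerSpectrum {n₁ n₂ m : ℕ} (V : Matrix (Dbl m) (Dbl m) ℂ)
    (G₁ : QLS n₁ m) (G₂ : QLS n₂ m) : Prop :=
  ∀ s : ℂ, s ∉ spectrum ℂ G₁.A → -(starRingEnd ℂ s) ∉ spectrum ℂ G₁.A →
    s ∉ spectrum ℂ G₂.A → -(starRingEnd ℂ s) ∉ spectrum ℂ G₂.A →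
    G₁.powerSpectrum V s = G₂.powerSpectrum V s

/-- Global minimality for the input covariance `V`: no Hurwitz-stable system with fewer modes has
the same power spectrum. -/
def IsGloballyMinimal {n m : ℕ} (V : Matrix (Dbl m) (Dbl m) ℂ) (G : QLS n m) : Prop :=
  ∀ k : ℕ, k < n → ∀ G' : QLS k m, G'.IsHurwitz → ¬ SamePowerSpectrum V G' G

/-- Symplectic similarity: the systems have the same number of modes, and
`A₂ = T A₁ T^♭`, `C₂ = C₁ T^♭` for some symplectic `T`. -/
def SymplecticallySimilar {n₁ n₂ m : ℕ} (G₁ : QLS n₁ m) (G₂ : QLS n₂ m) : Prop :=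
  n₁ = n₂ ∧ ∃ T : Matrix (Dbl n₂) (Dbl n₁) ℂ, IsSymplectic T ∧
    G₂.A = T * G₁.A * flat T ∧ G₂.C = G₁.C * flat T

end QLS

/-- The vacuum covariance `V_vac = [1, 0; 0, 0]`. -/
def vacuumCov (m : ℕ) : Matrix (Dbl m) (Dbl m) ℂ :=
  Matrix.fromBlocks 1 0 0 0

end

/-!
Write `B = J C†`, so that `C^♭ = B J`, and let `V` be the vacuum covariance. A similarity of systems
preserves the transfer function, and the transfer function determines the power spectrum; the point
is that equality of the power spectra of globally minimal systems yields a symplectic similarity.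

Let `P` be the stationary covariance, `A P + P A† + B V B† = 0`. Then
`Ψ(s) = V + C (s - A)⁻¹ K + (C (-s̄ - A)⁻¹ K)†` with `K = P C† - B V` (`QLS.powerSpectrum_eq`).
The two rational terms have poles in opposite half planes, so `Ψ` determines the moments `C Aᵏ K`:
expand at infinity and apply a polynomial that is `1` on `A` and `0` on `-A†`
(`moments_eq_of_paraHermitian_eq`). Hence, if `(A, C)` is observable and `(A, K)` controllable,
`Ψ` determines `(A, K, C)` up to a unique similarity (`exists_similarity`).

Observability follows from stability: `A + A^♭ + C^♭ C = 0` makes `A^♭` act as `-A` on unobservable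
vectors, although both matrices are stable (`QLS.injective_observabilityMap`).

Controllability follows from global minimality (`QLS.controllableSubspace_spectralInput`). Given
`A† x = μ x` and `K† x = 0` with `x ≠ 0`, either `J P x`, or the conjugate of `x` if `P x = 0`, is
an eigenvector of `A†` which `B†` maps into the annihilation-type channels
(`QLS.exists_passive_eigenvector`); comparison with the Lyapunov equation solved by `J` shows that
it has positive length for the form `x† J y`. This describes a mode driven by vacuum noise only, and
in the vacuum state itself. Compressing the system to the complement of the mode leaves the power
spectrum unchanged (`QLS.exists_reduction`), contradicting minimality. The compression is again a
quantum linear system because the complement has a symplectic basis (`exists_complement`).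

Finally the similarity `T` is symplectic: `T† J T` and `J` solve the same Lyapunov equation, whose
solution is unique, and `T` is doubled-up since its conjugate is another similarity of the same two
observable systems.
-/

/-! ### Stable matrices and Lyapunov equations -/

theorem mem_spectrum_of_mulVec_eq_smul {ι : Type*} [Fintype ι] [DecidableEq ι]
    {A : Matrix ι ι ℂ} {x : ι → ℂ} {μ : ℂ} (hx : x ≠ 0) (h : A *ᵥ x = μ • x) :
    μ ∈ spectrum ℂ A := by
  rw [← Matrix.spectrum_toLin', ← Module.End.hasEigenvalue_iff_mem_spectrum]
  exact Module.End.hasEigenvalue_of_hasEigenvector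
    ⟨Module.End.mem_eigenspace_iff.2 (by simpa using h), hx⟩

theorem exists_mulVec_eq_smul_of_mem_spectrum {ι : Type*} [Fintype ι] [DecidableEq ι]
    {A : Matrix ι ι ℂ} {μ : ℂ} (h : μ ∈ spectrum ℂ A) : ∃ x ≠ 0, A *ᵥ x = μ • x := by
  rw [← Matrix.spectrum_toLin', ← Module.End.hasEigenvalue_iff_mem_spectrum] at h
  obtain ⟨x, hx⟩ := h.exists_hasEigenvector
  exact ⟨x, hx.2, by simpa using hx.apply_eq_smul⟩

theorem mem_spectrum_conjTranspose {ι : Type*} [Fintype ι] [DecidableEq ι]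
    {A : Matrix ι ι ℂ} {μ : ℂ} : μ ∈ spectrum ℂ Aᴴ ↔ star μ ∈ spectrum ℂ A := by
  rw [← Matrix.star_eq_conjTranspose, spectrum.map_star, Set.mem_star]

/-- A nonzero subspace invariant under a complex matrix contains an eigenvector. -/
theorem exists_eigenvector_mem {ι : Type*} [Fintype ι]
    (A : Matrix ι ι ℂ) (p : Submodule ℂ (ι → ℂ)) (hp : p ≠ ⊥)
    (hA : ∀ x ∈ p, A *ᵥ x ∈ p) : ∃ x ∈ p, x ≠ 0 ∧ ∃ μ : ℂ, A *ᵥ x = μ • x := by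
  have : Nontrivial p := (Submodule.nontrivial_iff_ne_bot).2 hp
  obtain ⟨μ, hμ⟩ := Module.End.exists_eigenvalue (A.mulVecLin.restrict hA)
  obtain ⟨x, hx⟩ := hμ.exists_hasEigenvector
  refine ⟨x, x.2, by simpa using hx.2, μ, ?_⟩
  exact congrArg Subtype.val hx.apply_eq_smul

theorem isCoprime_charpoly_of_re {ι κ : Type*} [Fintype ι] [DecidableEq ι] [Fintype κ]
    [DecidableEq κ] {A : Matrix ι ι ℂ} {B : Matrix κ κ ℂ} (hA : ∀ μ ∈ spectrum ℂ A, μ.re < 0)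
    (hB : ∀ μ ∈ spectrum ℂ B, μ.re < 0) : IsCoprime A.charpoly (-Bᴴ).charpoly := by
  rw [Polynomial.isCoprime_iff_aeval_ne_zero_of_isAlgClosed ℂ ℂ]
  intro a
  by_contra! h
  have h1 := hA a (Matrix.mem_spectrum_iff_isRoot_charpoly.2 (by simpa using h.1))
  have h2 : a ∈ spectrum ℂ (-Bᴴ) :=
    Matrix.mem_spectrum_iff_isRoot_charpoly.2 (by simpa using h.2)
  rw [← spectrum.neg_eq, Set.mem_neg, mem_spectrum_conjTranspose] at h2
  have h3 := hB _ h2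
  simp at h3
  linarith

/-- Because the spectra of stable matrices and of their negated adjoints lie in opposite open half
planes, a single polynomial is the identity on the former and annihilates the latter. -/
theorem exists_polynomial_separating {ι κ : Type*} [Fintype ι] [DecidableEq ι] [Fintype κ]
    [DecidableEq κ] {A : Matrix ι ι ℂ} {B : Matrix κ κ ℂ} (hA : ∀ μ ∈ spectrum ℂ A, μ.re < 0)
    (hB : ∀ μ ∈ spectrum ℂ B, μ.re < 0) :
    ∃ p : Polynomial ℂ, Polynomial.aeval A p = 1 ∧ Polynomial.aeval B p = 1 ∧
      Polynomial.aeval (-Aᴴ) p = 0 ∧ Polynomial.aeval (-Bᴴ) p = 0 := by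
  have h : IsCoprime (A.charpoly * B.charpoly) ((-Aᴴ).charpoly * (-Bᴴ).charpoly) :=
    IsCoprime.mul_left
      (IsCoprime.mul_right (isCoprime_charpoly_of_re hA hA) (isCoprime_charpoly_of_re hA hB))
      (IsCoprime.mul_right (isCoprime_charpoly_of_re hB hA) (isCoprime_charpoly_of_re hB hB))
  obtain ⟨a, b, hab⟩ := h
  refine ⟨b * ((-Aᴴ).charpoly * (-Bᴴ).charpoly), ?_, ?_, ?_, ?_⟩
  · rw [eq_sub_of_add_eq' hab]; simp [Matrix.aeval_self_charpoly]
  · rw [eq_sub_of_add_eq' hab]; simp [Matrix.aeval_self_charpoly]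
  · simp [Matrix.aeval_self_charpoly]
  · simp [Matrix.aeval_self_charpoly]

theorem aeval_mul_eq_mul_aeval {ι κ : Type*} [Fintype ι] [DecidableEq ι] [Fintype κ]
    [DecidableEq κ] {A : Matrix ι ι ℂ} {B : Matrix κ κ ℂ} {X : Matrix ι κ ℂ} (h : A * X = X * B)
    (p : Polynomial ℂ) : Polynomial.aeval A p * X = X * Polynomial.aeval B p := by
  induction p using Polynomial.induction_on' with
  | add p q hp hq => simp [Matrix.add_mul, Matrix.mul_add, hp, hq]
  | monomial k a =>
    have : A ^ k * X = X * B ^ k := by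
      induction k with
      | zero => simp
      | succ k ih => rw [pow_succ, pow_succ, Matrix.mul_assoc, h, ← Matrix.mul_assoc, ih,
          Matrix.mul_assoc]
    simp [Polynomial.aeval_monomial, Algebra.algebraMap_eq_smul_one, this]

/-- The homogeneous Lyapunov equation of a stable matrix has only the zero solution. -/
theorem eq_zero_of_lyapunov {ι : Type*} [Fintype ι] [DecidableEq ι] {A X : Matrix ι ι ℂ}
    (hA : ∀ μ ∈ spectrum ℂ A, μ.re < 0) (h : A * X + X * Aᴴ = 0) : X = 0 := by
  obtain ⟨p, h1, -, h2, -⟩ := exists_polynomial_separating hA hA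
  have := aeval_mul_eq_mul_aeval (A := A) (B := -Aᴴ) (X := X)
    (by rw [Matrix.mul_neg]; exact eq_neg_of_add_eq_zero_left h) p
  simpa [h1, h2] using this

/-- The adjoint form of `eq_zero_of_lyapunov`. -/
theorem eq_zero_of_lyapunov_conjTranspose {ι : Type*} [Fintype ι] [DecidableEq ι]
    {A X : Matrix ι ι ℂ}
    (hA : ∀ μ ∈ spectrum ℂ A, μ.re < 0) (h : X * A + Aᴴ * X = 0) : X = 0 := by
  refine eq_zero_of_lyapunov (A := Aᴴ) (fun μ hμ => ?_) ?_
  · simpa using hA _ (mem_spectrum_conjTranspose.1 hμ)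
  · rw [Matrix.conjTranspose_conjTranspose, add_comm, h]

theorem exists_lyapunov_solution {ι : Type*} [Fintype ι] [DecidableEq ι] {A R : Matrix ι ι ℂ}
    (hA : ∀ μ ∈ spectrum ℂ A, μ.re < 0) (hR : Rᴴ = R) :
    ∃ P : Matrix ι ι ℂ, Pᴴ = P ∧ A * P + P * Aᴴ + R = 0 := by
  let f : Matrix ι ι ℂ →ₗ[ℂ] Matrix ι ι ℂ :=
    LinearMap.mulLeft ℂ A + LinearMap.mulRight ℂ Aᴴ
  have hf : ∀ X, f X = A * X + X * Aᴴ := fun X => rfl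
  have hinj : Function.Injective f := by
    rw [injective_iff_map_eq_zero]
    intro X hX
    exact eq_zero_of_lyapunov hA (by rw [← hf, hX])
  obtain ⟨P, hP⟩ := (LinearMap.injective_iff_surjective.1 hinj) (-R)
  rw [hf] at hP
  refine ⟨P, ?_, by rw [hP]; simp⟩
  have hP' := congrArg Matrix.conjTranspose hP
  simp only [Matrix.conjTranspose_add, Matrix.conjTranspose_mul, Matrix.conjTranspose_neg,
    Matrix.conjTranspose_conjTranspose, hR] at hP'
  refine hinj ?_
  rw [hf, hf, hP, ← hP', add_comm]

/-- An intertwiner of two matrices intertwines their resolvents. -/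
theorem inv_mul_eq_mul_inv_of_intertwine {ι κ : Type*} [Fintype ι] [DecidableEq ι] [Fintype κ]
    [DecidableEq κ] {A : Matrix ι ι ℂ} {B : Matrix κ κ ℂ} {E : Matrix ι κ ℂ} (h : A * E = E * B)
    {s : ℂ} (hA : IsUnit (s • (1 : Matrix ι ι ℂ) - A)) (hB : IsUnit (s • (1 : Matrix κ κ ℂ) - B)) :
    (s • (1 : Matrix ι ι ℂ) - A)⁻¹ * E = E * (s • (1 : Matrix κ κ ℂ) - B)⁻¹ := by
  have hA' := Matrix.nonsing_inv_mul _ ((Matrix.isUnit_iff_isUnit_det _).1 hA)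
  have hB' := Matrix.mul_nonsing_inv _ ((Matrix.isUnit_iff_isUnit_det _).1 hB)
  have hE : (s • (1 : Matrix ι ι ℂ) - A) * E = E * (s • (1 : Matrix κ κ ℂ) - B) := by
    rw [Matrix.sub_mul, Matrix.mul_sub, h]; simp
  calc (s • (1 : Matrix ι ι ℂ) - A)⁻¹ * E
      = (s • (1 : Matrix ι ι ℂ) - A)⁻¹ *
          (E * (s • (1 : Matrix κ κ ℂ) - B) * (s • (1 : Matrix κ κ ℂ) - B)⁻¹) := by
        rw [Matrix.mul_assoc E, hB', Matrix.mul_one]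
    _ = _ := by
        rw [← hE, ← Matrix.mul_assoc, ← Matrix.mul_assoc, hA', Matrix.one_mul]

/-! ### Moments of rational matrix functions -/

section Moments

variable {ι₁ ι₂ ι₃ ι₄ α β : Type*} [Fintype ι₁] [DecidableEq ι₁] [Fintype ι₂] [DecidableEq ι₂]
  [Fintype ι₃] [DecidableEq ι₃] [Fintype ι₄] [DecidableEq ι₄]

theorem eventually_isUnit_smul_one_sub (A : Matrix ι₁ ι₁ ℂ) :
    ∀ᶠ s in Bornology.cobounded ℂ, IsUnit (s • (1 : Matrix ι₁ ι₁ ℂ) - A) := by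
  have : (spectrum ℂ A).Finite := Matrix.finite_spectrum A
  filter_upwards [Bornology.isBounded_def.1 this.isBounded] with s hs
  have := spectrum.notMem_iff.1 hs
  rwa [Algebra.algebraMap_eq_smul_one] at this

theorem tendsto_smul_one_sub_inv (A : Matrix ι₁ ι₁ ℂ) :
    Filter.Tendsto (fun s : ℂ => (s • (1 : Matrix ι₁ ι₁ ℂ) - A)⁻¹) (Bornology.cobounded ℂ)
      (nhds 0) := by
  let _ : NormedRing (Matrix ι₁ ι₁ ℂ) := Matrix.linftyOpNormedRing
  let _ : NormedAlgebra ℂ (Matrix ι₁ ι₁ ℂ) := Matrix.linftyOpNormedAlgebra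
  have := spectrum.resolvent_tendsto_cobounded (𝕜 := ℂ) A
  refine this.congr fun s => ?_
  rw [Matrix.nonsing_inv_eq_ringInverse, resolvent, Algebra.algebraMap_eq_smul_one]

theorem tendsto_mul_inv_mul (X : Matrix α ι₁ ℂ) (A : Matrix ι₁ ι₁ ℂ) (Y : Matrix ι₁ β ℂ) :
    Filter.Tendsto (fun s : ℂ => X * (s • (1 : Matrix ι₁ ι₁ ℂ) - A)⁻¹ * Y)
      (Bornology.cobounded ℂ) (nhds 0) := by
  have hc : Continuous fun M : Matrix ι₁ ι₁ ℂ => X * M * Y := by fun_prop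
  have := (hc.tendsto 0).comp (tendsto_smul_one_sub_inv A)
  rwa [Matrix.mul_zero, Matrix.zero_mul] at this

theorem mul_inv_mul_expand (X : Matrix α ι₁ ℂ) (A : Matrix ι₁ ι₁ ℂ) (Y : Matrix ι₁ β ℂ) {s : ℂ}
    (hs : IsUnit (s • (1 : Matrix ι₁ ι₁ ℂ) - A)) :
    X * A * (s • (1 : Matrix ι₁ ι₁ ℂ) - A)⁻¹ * Y =
      s • (X * (s • (1 : Matrix ι₁ ι₁ ℂ) - A)⁻¹ * Y) - X * Y := by
  have h := Matrix.mul_nonsing_inv _ ((Matrix.isUnit_iff_isUnit_det _).1 hs)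
  have h' : A * (s • (1 : Matrix ι₁ ι₁ ℂ) - A)⁻¹ = s • (s • (1 : Matrix ι₁ ι₁ ℂ) - A)⁻¹ - 1 := by
    rw [Matrix.sub_mul, Matrix.smul_mul, Matrix.one_mul] at h
    exact eq_sub_of_add_eq' (sub_eq_iff_eq_add.1 h).symm
  rw [Matrix.mul_assoc X A, h']
  simp [Matrix.mul_sub, Matrix.sub_mul]

/-- If a sum of rational functions `X (s - A)⁻¹ Y` vanishes near infinity, so does its leading
Laurent coefficient there, and the remaining terms form a sum of the same kind. -/
theorem moments_eq_zero_step {X₁ : Matrix α ι₁ ℂ} {A₁ : Matrix ι₁ ι₁ ℂ} {Y₁ : Matrix ι₁ β ℂ}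
    {X₂ : Matrix α ι₂ ℂ} {A₂ : Matrix ι₂ ι₂ ℂ} {Y₂ : Matrix ι₂ β ℂ}
    {X₃ : Matrix α ι₃ ℂ} {A₃ : Matrix ι₃ ι₃ ℂ} {Y₃ : Matrix ι₃ β ℂ}
    {X₄ : Matrix α ι₄ ℂ} {A₄ : Matrix ι₄ ι₄ ℂ} {Y₄ : Matrix ι₄ β ℂ}
    (h : ∀ᶠ s in Bornology.cobounded ℂ,
      X₁ * (s • (1 : Matrix ι₁ ι₁ ℂ) - A₁)⁻¹ * Y₁ + X₂ * (s • (1 : Matrix ι₂ ι₂ ℂ) - A₂)⁻¹ * Y₂ +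
      X₃ * (s • (1 : Matrix ι₃ ι₃ ℂ) - A₃)⁻¹ * Y₃ +
      X₄ * (s • (1 : Matrix ι₄ ι₄ ℂ) - A₄)⁻¹ * Y₄ = 0) :
    X₁ * Y₁ + X₂ * Y₂ + X₃ * Y₃ + X₄ * Y₄ = 0 ∧
    ∀ᶠ s in Bornology.cobounded ℂ,
      X₁ * A₁ * (s • (1 : Matrix ι₁ ι₁ ℂ) - A₁)⁻¹ * Y₁ +
      X₂ * A₂ * (s • (1 : Matrix ι₂ ι₂ ℂ) - A₂)⁻¹ * Y₂ +
      X₃ * A₃ * (s • (1 : Matrix ι₃ ι₃ ℂ) - A₃)⁻¹ * Y₃ +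
      X₄ * A₄ * (s • (1 : Matrix ι₄ ι₄ ℂ) - A₄)⁻¹ * Y₄ = 0 := by
  have key : ∀ᶠ s in Bornology.cobounded ℂ,
      X₁ * A₁ * (s • (1 : Matrix ι₁ ι₁ ℂ) - A₁)⁻¹ * Y₁ +
      X₂ * A₂ * (s • (1 : Matrix ι₂ ι₂ ℂ) - A₂)⁻¹ * Y₂ +
      X₃ * A₃ * (s • (1 : Matrix ι₃ ι₃ ℂ) - A₃)⁻¹ * Y₃ +
      X₄ * A₄ * (s • (1 : Matrix ι₄ ι₄ ℂ) - A₄)⁻¹ * Y₄ =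
      -(X₁ * Y₁ + X₂ * Y₂ + X₃ * Y₃ + X₄ * Y₄) := by
    filter_upwards [h, eventually_isUnit_smul_one_sub A₁, eventually_isUnit_smul_one_sub A₂,
      eventually_isUnit_smul_one_sub A₃, eventually_isUnit_smul_one_sub A₄] with s hs h1 h2 h3 h4
    rw [mul_inv_mul_expand _ _ _ h1, mul_inv_mul_expand _ _ _ h2, mul_inv_mul_expand _ _ _ h3,
      mul_inv_mul_expand _ _ _ h4]
    have := congrArg (fun M => s • M) hs
    simp only [smul_add, smul_zero] at this
    rw [← sub_eq_zero, ← this]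
    abel
  have h0 : X₁ * Y₁ + X₂ * Y₂ + X₃ * Y₃ + X₄ * Y₄ = 0 := by
    have lim := (((tendsto_mul_inv_mul (X₁ * A₁) A₁ Y₁).add
      (tendsto_mul_inv_mul (X₂ * A₂) A₂ Y₂)).add
      (tendsto_mul_inv_mul (X₃ * A₃) A₃ Y₃)).add (tendsto_mul_inv_mul (X₄ * A₄) A₄ Y₄)
    have := tendsto_nhds_unique (tendsto_const_nhds.congr' (key.mono fun s hs => hs.symm)) lim
    rw [add_zero, add_zero, add_zero] at this
    exact neg_eq_zero.1 this
  refine ⟨h0, key.mono fun s hs => ?_⟩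
  rw [hs, h0, neg_zero]

/-- If a sum of rational functions `X (s - A)⁻¹ Y` vanishes near infinity, so do its Laurent
coefficients `X Aᵏ Y` there. -/
theorem moments_eq_zero {X₁ : Matrix α ι₁ ℂ} {A₁ : Matrix ι₁ ι₁ ℂ} {Y₁ : Matrix ι₁ β ℂ}
    {X₂ : Matrix α ι₂ ℂ} {A₂ : Matrix ι₂ ι₂ ℂ} {Y₂ : Matrix ι₂ β ℂ}
    {X₃ : Matrix α ι₃ ℂ} {A₃ : Matrix ι₃ ι₃ ℂ} {Y₃ : Matrix ι₃ β ℂ}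
    {X₄ : Matrix α ι₄ ℂ} {A₄ : Matrix ι₄ ι₄ ℂ} {Y₄ : Matrix ι₄ β ℂ}
    (h : ∀ᶠ s in Bornology.cobounded ℂ,
      X₁ * (s • (1 : Matrix ι₁ ι₁ ℂ) - A₁)⁻¹ * Y₁ + X₂ * (s • (1 : Matrix ι₂ ι₂ ℂ) - A₂)⁻¹ * Y₂ +
      X₃ * (s • (1 : Matrix ι₃ ι₃ ℂ) - A₃)⁻¹ * Y₃ +
      X₄ * (s • (1 : Matrix ι₄ ι₄ ℂ) - A₄)⁻¹ * Y₄ = 0)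
    (k : ℕ) :
    X₁ * A₁ ^ k * Y₁ + X₂ * A₂ ^ k * Y₂ + X₃ * A₃ ^ k * Y₃ + X₄ * A₄ ^ k * Y₄ = 0 := by
  induction k generalizing X₁ X₂ X₃ X₄ with
  | zero => simpa using (moments_eq_zero_step h).1
  | succ k ih => simpa only [pow_succ', Matrix.mul_assoc] using ih (moments_eq_zero_step h).2

end Moments

theorem aeval_sandwich_eq {ι₁ ι₂ ι₃ ι₄ α β : Type*} [Fintype ι₁] [DecidableEq ι₁] [Fintype ι₂]
    [DecidableEq ι₂] [Fintype ι₃] [DecidableEq ι₃] [Fintype ι₄] [DecidableEq ι₄]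
    {X₁ : Matrix α ι₁ ℂ} {A₁ : Matrix ι₁ ι₁ ℂ} {Y₁ : Matrix ι₁ β ℂ}
    {X₂ : Matrix α ι₂ ℂ} {A₂ : Matrix ι₂ ι₂ ℂ} {Y₂ : Matrix ι₂ β ℂ}
    {X₃ : Matrix α ι₃ ℂ} {A₃ : Matrix ι₃ ι₃ ℂ} {Y₃ : Matrix ι₃ β ℂ}
    {X₄ : Matrix α ι₄ ℂ} {A₄ : Matrix ι₄ ι₄ ℂ} {Y₄ : Matrix ι₄ β ℂ}
    (h : ∀ k : ℕ,
      X₁ * A₁ ^ k * Y₁ + X₂ * A₂ ^ k * Y₂ + X₃ * A₃ ^ k * Y₃ + X₄ * A₄ ^ k * Y₄ = 0)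
    (p : Polynomial ℂ) :
    X₁ * Polynomial.aeval A₁ p * Y₁ + X₂ * Polynomial.aeval A₂ p * Y₂ +
      X₃ * Polynomial.aeval A₃ p * Y₃ + X₄ * Polynomial.aeval A₄ p * Y₄ = 0 := by
  induction p using Polynomial.induction_on' with
  | add p q hp hq =>
    simp only [map_add, Matrix.mul_add, Matrix.add_mul]
    calc _ = _ := by abel
      _ = (0 : Matrix α β ℂ) + 0 := congrArg₂ (· + ·) hp hq
      _ = 0 := add_zero 0
  | monomial k a =>
    have := congrArg (fun M => a • M) (h k)
    simpa [Polynomial.aeval_monomial, Algebra.algebraMap_eq_smul_one] using this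

theorem conjTranspose_mul_inv_mul {ι α β : Type*} [Fintype ι] [DecidableEq ι]
    (X : Matrix α ι ℂ) (A : Matrix ι ι ℂ) (Y : Matrix ι β ℂ) (s : ℂ) :
    (X * ((-(starRingEnd ℂ s)) • (1 : Matrix ι ι ℂ) - A)⁻¹ * Y)ᴴ =
      Yᴴ * (-(s • (1 : Matrix ι ι ℂ) - -Aᴴ))⁻¹ * Xᴴ := by
  have : ((-(starRingEnd ℂ s)) • (1 : Matrix ι ι ℂ) - A)ᴴ =
      -(s • (1 : Matrix ι ι ℂ) - -Aᴴ) := by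
    simp [sub_eq_add_neg, add_comm]
  rw [Matrix.conjTranspose_mul, Matrix.conjTranspose_mul, Matrix.conjTranspose_nonsing_inv, this,
    Matrix.mul_assoc]

theorem neg_inv_of_isUnit {ι : Type*} [Fintype ι] [DecidableEq ι] {A : Matrix ι ι ℂ}
    (hA : IsUnit A) : (-A)⁻¹ = -A⁻¹ := by
  refine Matrix.inv_eq_left_inv ?_
  rw [neg_mul_neg, Matrix.nonsing_inv_mul _ ((Matrix.isUnit_iff_isUnit_det _).1 hA)]

/-- The para-Hermitian rational function `X (s - A)⁻¹ Y + (X (-s̄ - A)⁻¹ Y)†`, with `A` stable,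
determines the moments `X Aᵏ Y` of its stable part. -/
theorem moments_eq_of_paraHermitian_eq {ι κ α : Type*} [Fintype ι] [DecidableEq ι] [Fintype κ]
    [DecidableEq κ] {A₁ : Matrix ι ι ℂ} {A₂ : Matrix κ κ ℂ}
    (h₁ : ∀ μ ∈ spectrum ℂ A₁, μ.re < 0) (h₂ : ∀ μ ∈ spectrum ℂ A₂, μ.re < 0)
    (X₁ : Matrix α ι ℂ) (Y₁ : Matrix ι α ℂ) (X₂ : Matrix α κ ℂ) (Y₂ : Matrix κ α ℂ)
    (h : ∀ᶠ s in Bornology.cobounded ℂ,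
      X₁ * (s • (1 : Matrix ι ι ℂ) - A₁)⁻¹ * Y₁ +
        (X₁ * ((-(starRingEnd ℂ s)) • (1 : Matrix ι ι ℂ) - A₁)⁻¹ * Y₁)ᴴ =
      X₂ * (s • (1 : Matrix κ κ ℂ) - A₂)⁻¹ * Y₂ +
        (X₂ * ((-(starRingEnd ℂ s)) • (1 : Matrix κ κ ℂ) - A₂)⁻¹ * Y₂)ᴴ) (k : ℕ) :
    X₁ * A₁ ^ k * Y₁ = X₂ * A₂ ^ k * Y₂ := by
  have h0 := moments_eq_zero (X₁ := X₁) (A₁ := A₁) (Y₁ := Y₁) (X₂ := -X₂) (A₂ := A₂) (Y₂ := Y₂)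
    (X₃ := -Y₁ᴴ) (A₃ := -A₁ᴴ) (Y₃ := X₁ᴴ) (X₄ := Y₂ᴴ) (A₄ := -A₂ᴴ) (Y₄ := X₂ᴴ) (by
      filter_upwards [h, eventually_isUnit_smul_one_sub (-A₁ᴴ),
        eventually_isUnit_smul_one_sub (-A₂ᴴ)] with s hs u1 u2
      rw [conjTranspose_mul_inv_mul, conjTranspose_mul_inv_mul, neg_inv_of_isUnit u1,
        neg_inv_of_isUnit u2, ← sub_eq_zero] at hs
      rw [← hs]
      simp only [Matrix.neg_mul, Matrix.mul_neg]
      abel)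
  obtain ⟨p, p1, p2, p3, p4⟩ := exists_polynomial_separating h₁ h₂
  have := aeval_sandwich_eq h0 (p * Polynomial.X ^ k)
  simp only [map_mul, p1, p2, p3, p4, map_pow, Polynomial.aeval_X, one_mul, zero_mul,
    Matrix.mul_zero, Matrix.zero_mul, add_zero, Matrix.neg_mul] at this
  exact add_neg_eq_zero.1 this

/-! ### Similarity of observable and controllable realizations -/

section Realization

variable {ι κ α β : Type*} [Fintype ι] [DecidableEq ι] [Fintype κ] [DecidableEq κ]

/-- The observability map, sending a state `x` to the sequence of outputs `X Aᵏ x`. -/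
def observabilityMap (X : Matrix α ι ℂ) (A : Matrix ι ι ℂ) : (ι → ℂ) →ₗ[ℂ] (ℕ → α → ℂ) :=
  LinearMap.pi fun k => (X * A ^ k).mulVecLin

theorem observabilityMap_apply (X : Matrix α ι ℂ) (A : Matrix ι ι ℂ) (x : ι → ℂ) (k : ℕ) :
    observabilityMap X A x k = (X * A ^ k) *ᵥ x := rfl

theorem observabilityMap_mulVec (X : Matrix α ι ℂ) (A : Matrix ι ι ℂ) (x : ι → ℂ) (k : ℕ) :
    observabilityMap X A (A *ᵥ x) k = observabilityMap X A x (k + 1) := by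
  simp [observabilityMap_apply, pow_succ, Matrix.mul_assoc]

/-- The Popov-Belevitch-Hautus test for observability. -/
theorem injective_observabilityMap {X : Matrix α ι ℂ} {A : Matrix ι ι ℂ}
    (h : ∀ (x : ι → ℂ) (μ : ℂ), A *ᵥ x = μ • x → X *ᵥ x = 0 → x = 0) :
    Function.Injective (observabilityMap X A) := by
  rw [← LinearMap.ker_eq_bot]
  by_contra hne
  obtain ⟨x, hx, hx0, μ, hμ⟩ := exists_eigenvector_mem A _ hne (fun x hx => by
    rw [LinearMap.mem_ker] at hx ⊢
    ext1 k
    rw [observabilityMap_mulVec, hx]; rfl)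
  refine hx0 (h x μ hμ ?_)
  simpa [observabilityMap_apply] using congrFun (LinearMap.mem_ker.1 hx) 0

/-- The controllable subspace, spanned by the columns of the matrices `Aᵏ Y`. -/
def controllableSubspace (A : Matrix ι ι ℂ) (Y : Matrix ι β ℂ) : Submodule ℂ (ι → ℂ) :=
  Submodule.span ℂ (Set.range fun q : ℕ × β => fun i => (A ^ q.1 * Y) i q.2)

/-- The Popov-Belevitch-Hautus test for controllability, dual to the one for observability. -/
theorem controllableSubspace_eq_top [Fintype β] {A : Matrix ι ι ℂ} {Y : Matrix ι β ℂ}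
    (h : ∀ (x : ι → ℂ) (μ : ℂ), Aᴴ *ᵥ x = μ • x → Yᴴ *ᵥ x = 0 → x = 0) :
    controllableSubspace A Y = ⊤ := by
  by_contra hne
  obtain ⟨f, hf0, hf⟩ := Submodule.exists_le_ker_of_lt_top _ (lt_top_iff_ne_top.2 hne)
  let x : ι → ℂ := fun i => star (f (Pi.single i 1))
  have hfx : ∀ y : ι → ℂ, f y = star x ⬝ᵥ y := by
    intro y
    conv_lhs => rw [← Finset.univ_sum_single y]
    rw [map_sum]
    refine Finset.sum_congr rfl fun i _ => ?_
    have : Pi.single i (y i) = y i • (Pi.single i 1 : ι → ℂ) := by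
      rw [← Pi.single_smul]; simp
    rw [this, map_smul]
    simp [x, mul_comm]
  have hinj := injective_observabilityMap h
  have hx : observabilityMap Yᴴ Aᴴ x = 0 := by
    ext k j
    have h1 : f (fun i => (A ^ k * Y) i j) = 0 :=
      LinearMap.mem_ker.1 (hf (Submodule.subset_span ⟨(k, j), rfl⟩))
    rw [hfx] at h1
    have h2 := congrArg star h1
    rw [observabilityMap_apply, ← Matrix.conjTranspose_pow, ← Matrix.conjTranspose_mul]
    simpa [Matrix.mulVec, dotProduct, mul_comm] using h2
  have hx0 : x = 0 := hinj (by rw [hx, map_zero])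
  refine hf0 (LinearMap.ext fun y => ?_)
  rw [hfx, hx0]; simp

theorem range_observabilityMap {X : Matrix α ι ℂ} {A : Matrix ι ι ℂ} {Y : Matrix ι β ℂ}
    (hY : controllableSubspace A Y = ⊤) :
    LinearMap.range (observabilityMap X A) =
      Submodule.span ℂ (Set.range fun q : ℕ × β => fun k a => (X * A ^ (k + q.1) * Y) a q.2) := by
  rw [LinearMap.range_eq_map, ← hY, controllableSubspace, Submodule.map_span, ← Set.range_comp]
  congr 2
  ext q k a
  simp only [Function.comp, observabilityMap_apply, pow_add]
  rw [← Matrix.mul_assoc X, Matrix.mul_assoc (X * A ^ k)]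
  rfl

/-- Two observable and controllable realizations with the same moments are similar. -/
theorem exists_similarity {X₁ : Matrix α ι ℂ} {A₁ : Matrix ι ι ℂ} {Y₁ : Matrix ι β ℂ}
    {X₂ : Matrix α κ ℂ} {A₂ : Matrix κ κ ℂ} {Y₂ : Matrix κ β ℂ}
    (ho₁ : Function.Injective (observabilityMap X₁ A₁))
    (ho₂ : Function.Injective (observabilityMap X₂ A₂))
    (hc₁ : controllableSubspace A₁ Y₁ = ⊤) (hc₂ : controllableSubspace A₂ Y₂ = ⊤)
    (h : ∀ k, X₁ * A₁ ^ k * Y₁ = X₂ * A₂ ^ k * Y₂) :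
    Fintype.card ι = Fintype.card κ ∧
      ∃ T : Matrix κ ι ℂ, X₂ * T = X₁ ∧ T * A₁ = A₂ * T := by
  have hr : LinearMap.range (observabilityMap X₁ A₁) =
      LinearMap.range (observabilityMap X₂ A₂) := by
    rw [range_observabilityMap hc₁, range_observabilityMap hc₂]
    simp only [h]
  let e : (ι → ℂ) ≃ₗ[ℂ] (κ → ℂ) :=
    ((LinearEquiv.ofInjective _ ho₁).trans (LinearEquiv.ofEq _ _ hr)).trans
      (LinearEquiv.ofInjective _ ho₂).symm
  have he : ∀ x, observabilityMap X₂ A₂ (e x) = observabilityMap X₁ A₁ x := fun x =>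
    congrArg Subtype.val ((LinearEquiv.ofInjective _ ho₂).apply_symm_apply
      (LinearEquiv.ofEq _ _ hr (LinearEquiv.ofInjective _ ho₁ x)))
  have hT : ∀ x, LinearMap.toMatrix' e.toLinearMap *ᵥ x = e x := fun x => by
    rw [← Matrix.toLin'_apply, Matrix.toLin'_toMatrix']; rfl
  refine ⟨by simpa using e.finrank_eq, LinearMap.toMatrix' e.toLinearMap, ?_, ?_⟩
  · rw [Matrix.ext_iff_mulVec]
    intro x
    rw [← Matrix.mulVec_mulVec, hT]
    simpa [observabilityMap_apply] using congrFun (he x) 0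
  · rw [Matrix.ext_iff_mulVec]
    intro x
    rw [← Matrix.mulVec_mulVec, ← Matrix.mulVec_mulVec, hT, hT]
    refine ho₂ ?_
    ext1 k
    rw [he, observabilityMap_mulVec, observabilityMap_mulVec, he]

/-- A similarity between realizations is determined by observability. -/
theorem similarity_unique {X₁ : Matrix α ι ℂ} {A₁ : Matrix ι ι ℂ}
    {X₂ : Matrix α κ ℂ} {A₂ : Matrix κ κ ℂ} (ho₂ : Function.Injective (observabilityMap X₂ A₂))
    {T T' : Matrix κ ι ℂ} (h₁ : X₂ * T = X₁) (h₂ : T * A₁ = A₂ * T)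
    (h₁' : X₂ * T' = X₁) (h₂' : T' * A₁ = A₂ * T') : T = T' := by
  have key : ∀ (S : Matrix κ ι ℂ), X₂ * S = X₁ → S * A₁ = A₂ * S → ∀ k,
      X₂ * A₂ ^ k * S = X₁ * A₁ ^ k := by
    intro S s1 s2 k
    induction k with
    | zero => simpa using s1
    | succ k ih => rw [pow_succ, pow_succ, ← Matrix.mul_assoc, Matrix.mul_assoc _ A₂, ← s2,
        ← Matrix.mul_assoc, ih, Matrix.mul_assoc]
  rw [Matrix.ext_iff_mulVec]
  intro x
  refine ho₂ ?_
  ext1 k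
  simp only [observabilityMap_apply, Matrix.mulVec_mulVec, key T h₁ h₂, key T' h₁' h₂']

end Realization

/-! ### Doubled-up matrices and the indefinite form -/

/-- The antilinear involution `(a, b) ↦ (b̄, ā)` of the doubled-up space. -/
def dblConj {k : ℕ} (x : Dbl k → ℂ) : Dbl k → ℂ := fun i => star (x i.swap)

/-- Conjugation of a matrix by the involutions `dblConj` of its source and target. The doubled-up
matrices are its fixed points. -/
def dblConjMat {k l : ℕ} (M : Matrix (Dbl k) (Dbl l) ℂ) : Matrix (Dbl k) (Dbl l) ℂ :=
  fun i j => star (M i.swap j.swap)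

theorem sum_comp_swap {k : ℕ} (f : Dbl k → ℂ) : ∑ i : Dbl k, f i.swap = ∑ i, f i :=
  (Equiv.sumComm (Fin k) (Fin k)).sum_comp f

theorem exists_eq_doubledUp_iff {k l : ℕ} {M : Matrix (Dbl k) (Dbl l) ℂ} :
    (∃ X Y : Matrix (Fin k) (Fin l) ℂ, M = doubledUp X Y) ↔ dblConjMat M = M := by
  constructor
  · rintro ⟨X, Y, rfl⟩
    ext (i | i) (j | j) <;> simp [dblConjMat, doubledUp]
  · intro h
    refine ⟨M.toBlocks₁₁, M.toBlocks₁₂, ?_⟩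
    ext (i | i) (j | j)
    · rfl
    · rfl
    · exact (congrFun (congrFun h (Sum.inr i)) (Sum.inl j)).symm
    · exact (congrFun (congrFun h (Sum.inr i)) (Sum.inr j)).symm

@[simp] theorem dblConjMat_doubledUp {k l : ℕ} (X Y : Matrix (Fin k) (Fin l) ℂ) :
    dblConjMat (doubledUp X Y) = doubledUp X Y :=
  exists_eq_doubledUp_iff.1 ⟨X, Y, rfl⟩

theorem dblConjMat_mul {k l r : ℕ} (M : Matrix (Dbl k) (Dbl l) ℂ) (N : Matrix (Dbl l) (Dbl r) ℂ) :
    dblConjMat (M * N) = dblConjMat M * dblConjMat N := by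
  ext i j
  simp only [dblConjMat, Matrix.mul_apply, star_sum, star_mul']
  exact (sum_comp_swap fun x => star (M i.swap x) * star (N x j.swap)).symm

theorem dblConjMat_conjTranspose {k l : ℕ} (M : Matrix (Dbl k) (Dbl l) ℂ) :
    dblConjMat Mᴴ = (dblConjMat M)ᴴ := rfl

theorem dblConjMat_add {k l : ℕ} (M N : Matrix (Dbl k) (Dbl l) ℂ) :
    dblConjMat (M + N) = dblConjMat M + dblConjMat N := by
  ext i j; simp [dblConjMat]

theorem dblConjMat_smul {k l : ℕ} (c : ℂ) (M : Matrix (Dbl k) (Dbl l) ℂ) :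
    dblConjMat (c • M) = star c • dblConjMat M := by
  ext i j; simp [dblConjMat]

theorem dblConjMat_mulVec {k l : ℕ} (M : Matrix (Dbl k) (Dbl l) ℂ) (x : Dbl l → ℂ) :
    dblConjMat M *ᵥ dblConj x = dblConj (M *ᵥ x) := by
  ext i
  simp only [dblConjMat, dblConj, Matrix.mulVec, dotProduct, star_sum, star_mul']
  exact sum_comp_swap fun j => star (M i.swap j) * star (x j)

@[simp] theorem dblConj_dblConj {k : ℕ} (x : Dbl k → ℂ) : dblConj (dblConj x) = x := by
  ext i; simp [dblConj]

theorem dblConj_smul {k : ℕ} (c : ℂ) (x : Dbl k → ℂ) : dblConj (c • x) = star c • dblConj x := by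
  ext i; simp [dblConj]

theorem dblConj_neg {k : ℕ} (x : Dbl k → ℂ) : dblConj (-x) = -dblConj x := by
  ext i; simp [dblConj]

@[simp] theorem dblConj_zero {k : ℕ} : dblConj (0 : Dbl k → ℂ) = 0 := by
  ext i; simp [dblConj]

@[simp] theorem matJ_mul_matJ (k : ℕ) : matJ k * matJ k = 1 := by
  simp [matJ, Matrix.fromBlocks_multiply, Matrix.fromBlocks_one]

@[simp] theorem conjTranspose_matJ (k : ℕ) : (matJ k)ᴴ = matJ k := by
  simp [matJ, Matrix.fromBlocks_conjTranspose]

@[simp] theorem matJ_mul_matJ_mul {k : ℕ} {α : Type*} (M : Matrix (Dbl k) α ℂ) :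
    matJ k * (matJ k * M) = M := by
  rw [← Matrix.mul_assoc, matJ_mul_matJ, Matrix.one_mul]

@[simp] theorem matJ_mulVec_matJ_mulVec {k : ℕ} (x : Dbl k → ℂ) :
    matJ k *ᵥ (matJ k *ᵥ x) = x := by
  simp

theorem matJ_mulVec_inl {k : ℕ} (x : Dbl k → ℂ) (i : Fin k) :
    (matJ k *ᵥ x) (Sum.inl i) = x (Sum.inl i) := by
  simp [matJ, Matrix.fromBlocks_mulVec]

theorem matJ_mulVec_inr {k : ℕ} (x : Dbl k → ℂ) (i : Fin k) :
    (matJ k *ᵥ x) (Sum.inr i) = -x (Sum.inr i) := by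
  simp [matJ, Matrix.fromBlocks_mulVec, Matrix.neg_mulVec]

theorem dblConjMat_matJ (k : ℕ) : dblConjMat (matJ k) = -matJ k := by
  ext (i | i) (j | j) <;> simp [dblConjMat, matJ, Matrix.one_apply, apply_ite]

theorem dblConj_matJ_mulVec {k : ℕ} (x : Dbl k → ℂ) :
    dblConj (matJ k *ᵥ x) = -(matJ k *ᵥ dblConj x) := by
  rw [← dblConjMat_mulVec, dblConjMat_matJ, Matrix.neg_mulVec]

/-- The indefinite Hermitian form `x† J y`. -/
def formJ {k : ℕ} (x y : Dbl k → ℂ) : ℂ := star x ⬝ᵥ (matJ k *ᵥ y)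

theorem star_dotProduct_mulVec {ι κ : Type*} [Fintype ι] [Fintype κ] (M : Matrix ι κ ℂ)
    (x : ι → ℂ) (y : κ → ℂ) : star x ⬝ᵥ (M *ᵥ y) = star (Mᴴ *ᵥ x) ⬝ᵥ y := by
  rw [Matrix.star_mulVec, Matrix.conjTranspose_conjTranspose, Matrix.dotProduct_mulVec]

theorem star_star_dotProduct {ι : Type*} [Fintype ι] (x y : ι → ℂ) :
    star (star x ⬝ᵥ y) = star y ⬝ᵥ x := by
  rw [← Matrix.star_dotProduct_star, star_star]

theorem formJ_symm {k : ℕ} (x y : Dbl k → ℂ) : star (formJ x y) = formJ y x := by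
  rw [formJ, star_star_dotProduct, formJ, star_dotProduct_mulVec, conjTranspose_matJ]

theorem star_dotProduct_self {ι : Type*} [Fintype ι] (x : ι → ℂ) :
    star x ⬝ᵥ x = ((∑ i, Complex.normSq (x i) : ℝ) : ℂ) := by
  simp [dotProduct, Complex.normSq_eq_conj_mul_self]

theorem star_dotProduct_self_eq_zero_iff {ι : Type*} [Fintype ι] (x : ι → ℂ) :
    star x ⬝ᵥ x = 0 ↔ x = 0 := by
  rw [star_dotProduct_self, Complex.ofReal_eq_zero,
    Finset.sum_eq_zero_iff_of_nonneg fun i _ => Complex.normSq_nonneg _]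
  simp [funext_iff]

theorem dblConj_dotProduct_dblConj {k : ℕ} (x y : Dbl k → ℂ) :
    star (dblConj x) ⬝ᵥ dblConj y = star (star x ⬝ᵥ y) := by
  simp only [dotProduct, dblConj, Pi.star_apply, star_sum, star_mul', star_star]
  exact sum_comp_swap fun i => x i * star (y i)

theorem formJ_dblConj_dblConj {k : ℕ} (x y : Dbl k → ℂ) :
    formJ (dblConj x) (dblConj y) = -star (formJ x y) := by
  have : matJ k *ᵥ dblConj y = -dblConj (matJ k *ᵥ y) := by rw [dblConj_matJ_mulVec, neg_neg]
  rw [formJ, this, dotProduct_neg, dblConj_dotProduct_dblConj, formJ]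

theorem formJ_dblConj_right {k : ℕ} (x y : Dbl k → ℂ) :
    formJ x (dblConj y) = -star (formJ (dblConj x) y) := by
  rw [← formJ_dblConj_dblConj, dblConj_dblConj]

/-- A vector and its conjugate are always orthogonal for the indefinite form, because
`(x, y) ↦ formJ x (dblConj y)` is the conjugate of an alternating form. -/
theorem formJ_self_dblConj {k : ℕ} (x : Dbl k → ℂ) : formJ x (dblConj x) = 0 := by
  simp only [formJ, dotProduct, Fintype.sum_sum_type, matJ_mulVec_inl, matJ_mulVec_inr]
  simp [dblConj, mul_comm]

theorem formJ_smul_left {k : ℕ} (c : ℂ) (x y : Dbl k → ℂ) :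
    formJ (c • x) y = star c * formJ x y := by
  simp [formJ, smul_dotProduct]

theorem formJ_smul_right {k : ℕ} (c : ℂ) (x y : Dbl k → ℂ) :
    formJ x (c • y) = c * formJ x y := by
  simp [formJ, Matrix.mulVec_smul, dotProduct_smul]

theorem formJ_matJ_mulVec_left {k : ℕ} (x y : Dbl k → ℂ) :
    formJ (matJ k *ᵥ x) y = star x ⬝ᵥ y := by
  rw [formJ, star_dotProduct_mulVec, conjTranspose_matJ, matJ_mulVec_matJ_mulVec]

theorem exists_smul_formJ_eq_one {k : ℕ} {x : Dbl k → ℂ} {r : ℝ} (hr : 0 < r)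
    (hx : formJ x x = r) : ∃ c : ℂ, formJ (c • x) (c • x) = 1 := by
  refine ⟨((Real.sqrt r)⁻¹ : ℂ), ?_⟩
  have h2 : ((Real.sqrt r : ℝ) : ℂ) * (Real.sqrt r : ℝ) = (r : ℂ) := by
    rw [← Complex.ofReal_mul, Real.mul_self_sqrt hr.le]
  have h3 : ((Real.sqrt r : ℝ) : ℂ) ≠ 0 := by
    exact_mod_cast (Real.sqrt_pos.2 hr).ne'
  rw [formJ_smul_left, formJ_smul_right, hx, ← h2]
  simp only [star_inv₀, Complex.star_def, Complex.conj_ofReal]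
  field_simp

theorem formJ_mulVec {k l : ℕ} (F : Matrix (Dbl k) (Dbl l) ℂ) (x : Dbl l → ℂ) (y : Dbl k → ℂ) :
    formJ (F *ᵥ x) y = formJ x (flat F *ᵥ y) := by
  rw [formJ, formJ, flat, Matrix.mul_assoc, ← Matrix.mulVec_mulVec, matJ_mulVec_matJ_mulVec,
    ← Matrix.mulVec_mulVec, star_dotProduct_mulVec Fᴴ, Matrix.conjTranspose_conjTranspose]

@[simp] theorem flat_flat {k l : ℕ} (Z : Matrix (Dbl k) (Dbl l) ℂ) : flat (flat Z) = Z := by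
  simp [flat, Matrix.mul_assoc]

theorem flat_mul {k l r : ℕ} (M : Matrix (Dbl k) (Dbl l) ℂ) (N : Matrix (Dbl l) (Dbl r) ℂ) :
    flat (M * N) = flat N * flat M := by
  simp [flat, Matrix.mul_assoc]

theorem dblConjMat_flat {k l : ℕ} (Z : Matrix (Dbl k) (Dbl l) ℂ) :
    dblConjMat (flat Z) = flat (dblConjMat Z) := by
  simp [flat, dblConjMat_mul, dblConjMat_matJ, dblConjMat_conjTranspose]

/-- The doubled-up matrix with columns `e j` and `dblConj (e j)`. -/
def dblColumns {n r : ℕ} (e : Fin r → Dbl n → ℂ) : Matrix (Dbl n) (Dbl r) ℂ :=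
  fun i => Sum.elim (fun j => e j i) (fun j => dblConj (e j) i)

theorem dblConjMat_dblColumns {n r : ℕ} (e : Fin r → Dbl n → ℂ) :
    dblConjMat (dblColumns e) = dblColumns e := by
  ext i (j | j) <;> simp [dblConjMat, dblColumns, dblConj]

theorem flat_dblColumns_mulVec {n r : ℕ} (e : Fin r → Dbl n → ℂ) (x : Dbl n → ℂ) :
    flat (dblColumns e) *ᵥ x =
      Sum.elim (fun j => formJ (e j) x) (fun j => -formJ (dblConj (e j)) x) := by
  rw [flat, ← Matrix.mulVec_mulVec, ← Matrix.mulVec_mulVec]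
  ext (j | j)
  · rw [matJ_mulVec_inl]; rfl
  · rw [matJ_mulVec_inr]; rfl

theorem flat_dblColumns_mul_self {n r : ℕ} {e : Fin r → Dbl n → ℂ}
    (h1 : ∀ i j, formJ (e i) (e j) = if i = j then 1 else 0)
    (h2 : ∀ i j, formJ (e i) (dblConj (e j)) = 0) :
    flat (dblColumns e) * dblColumns e = 1 := by
  have key : ∀ (i j : Dbl r), (flat (dblColumns e) * dblColumns e) i j =
      (flat (dblColumns e) *ᵥ (fun a => dblColumns e a j)) i := fun i j => rfl
  ext (i | i) (j | j)
  · rw [key, flat_dblColumns_mulVec]; simpa [dblColumns, Matrix.one_apply] using h1 i j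
  · rw [key, flat_dblColumns_mulVec]; simpa [dblColumns] using h2 i j
  · rw [key, flat_dblColumns_mulVec]
    have := formJ_dblConj_right (e i) (e j)
    rw [h2] at this
    simpa [dblColumns] using this
  · rw [key, flat_dblColumns_mulVec]
    have := h1 i j
    simp [dblColumns, formJ_dblConj_dblConj, this, Matrix.one_apply, apply_ite]

/-- A Hermitian idempotent for the indefinite form that commutes with `dblConj` and does not
vanish has a vector of unit length in its range. -/
theorem exists_formJ_eq_one {n : ℕ} {Q : Matrix (Dbl n) (Dbl n) ℂ} (hQ : flat Q = Q)
    (hQ2 : Q * Q = Q) (hconj : dblConjMat Q = Q) (h0 : Q ≠ 0) :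
    ∃ g : Dbl n → ℂ, Q *ᵥ g = g ∧ formJ g g = 1 := by
  have hne : ∃ u, formJ (Q *ᵥ u) (Q *ᵥ u) ≠ 0 := by
    by_contra! hall
    refine h0 ?_
    -- polarization: a sesquilinear form with vanishing diagonal vanishes
    have hpol : ∀ u w, formJ u (Q *ᵥ w) = 0 := by
      intro u w
      have q : ∀ z, formJ z (Q *ᵥ z) = 0 := fun z => by
        rw [← hall z, formJ_mulVec, hQ, Matrix.mulVec_mulVec, hQ2]
      have add1 : ∀ a b c : Dbl n → ℂ, formJ (a + b) c = formJ a c + formJ b c := by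
        intro a b c; simp [formJ, add_dotProduct]
      have add2 : ∀ a b c : Dbl n → ℂ, formJ a (b + c) = formJ a b + formJ a c := by
        intro a b c; simp [formJ, Matrix.mulVec_add, dotProduct_add]
      have e1 := q (u + w)
      have e2 := q (u + Complex.I • w)
      rw [Matrix.mulVec_add, add1, add2, add2, q u, q w] at e1
      rw [Matrix.mulVec_add, Matrix.mulVec_smul, add1, add2, add2, formJ_smul_left,
        formJ_smul_left, formJ_smul_right, formJ_smul_right, q u, q w] at e2
      simp only [zero_add, add_zero, mul_zero, Complex.star_def, Complex.conj_I] at e1 e2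
      have : 2 * Complex.I * formJ u (Q *ᵥ w) = 0 := by
        linear_combination Complex.I * e1 + e2
      simpa using this
    rw [Matrix.ext_iff_mulVec]
    intro w
    rw [Matrix.zero_mulVec, ← star_dotProduct_self_eq_zero_iff]
    have := hpol (matJ n *ᵥ (Q *ᵥ w)) w
    rwa [formJ, star_dotProduct_mulVec, conjTranspose_matJ, matJ_mulVec_matJ_mulVec] at this
  obtain ⟨u, hu⟩ := hne
  -- after conjugating if necessary the length is positive
  have hpos : ∃ g : Dbl n → ℂ, Q *ᵥ g = g ∧ 0 < (formJ g g).re := by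
    have him : (formJ (Q *ᵥ u) (Q *ᵥ u)).im = 0 := by
      have := congrArg Complex.im (formJ_symm (Q *ᵥ u) (Q *ᵥ u))
      simp only [Complex.star_def, Complex.conj_im] at this
      linarith
    have hfix : Q *ᵥ (Q *ᵥ u) = Q *ᵥ u := by rw [Matrix.mulVec_mulVec, hQ2]
    rcases lt_trichotomy (formJ (Q *ᵥ u) (Q *ᵥ u)).re 0 with hlt | heq | hgt
    · refine ⟨dblConj (Q *ᵥ u), ?_, ?_⟩
      · have := dblConjMat_mulVec Q (Q *ᵥ u)
        rwa [hconj, hfix] at this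
      · rw [formJ_dblConj_dblConj]; simpa using hlt
    · exact absurd (Complex.ext heq him) hu
    · exact ⟨_, hfix, hgt⟩
  obtain ⟨g, hg, hgpos⟩ := hpos
  have hreal : formJ g g = ((formJ g g).re : ℂ) := by
    have := formJ_symm g g
    exact (Complex.conj_eq_iff_real.1 this).elim fun r hr => by rw [hr]; simp
  obtain ⟨c, hc⟩ := exists_smul_formJ_eq_one hgpos hreal
  exact ⟨c • g, by rw [Matrix.mulVec_smul, hg], hc⟩

/-- Gram-Schmidt extension: a vector of unit length is the first column of a symplectic frame. -/
theorem exists_symplectic_frame {n : ℕ} {f : Dbl n → ℂ} (hf : formJ f f = 1) (r : ℕ) (hr : r < n) :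
    ∃ e : Fin (r + 1) → Dbl n → ℂ, e 0 = f ∧
      (∀ i j, formJ (e i) (e j) = if i = j then 1 else 0) ∧
      ∀ i j, formJ (e i) (dblConj (e j)) = 0 := by
  induction r with
  | zero =>
    refine ⟨fun _ => f, rfl, fun i j => ?_, fun i j => formJ_self_dblConj f⟩
    rw [if_pos (by omega), hf]
  | succ r ih =>
    obtain ⟨e, he0, he1, he2⟩ := ih (by omega)
    have hE := flat_dblColumns_mul_self he1 he2
    set E := dblColumns e with hEdef
    have hEc : dblConjMat E = E := dblConjMat_dblColumns e
    -- the projection onto the complement of the frame has trace `2 n - 2 (r + 1)`, so is nonzero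
    obtain ⟨g, hg, hg1⟩ := exists_formJ_eq_one (Q := 1 - E * flat E) (by
        simp only [flat, Matrix.conjTranspose_sub, Matrix.mul_sub, Matrix.sub_mul,
          Matrix.conjTranspose_mul, Matrix.conjTranspose_one, conjTranspose_matJ,
          Matrix.conjTranspose_conjTranspose, Matrix.mul_assoc, matJ_mul_matJ_mul, Matrix.mul_one,
          matJ_mul_matJ]) (by
        have : E * flat E * (E * flat E) = E * flat E := by
          rw [Matrix.mul_assoc, ← Matrix.mul_assoc (flat E), hE, Matrix.one_mul]
        rw [Matrix.mul_sub, Matrix.sub_mul _ _ (E * flat E), this]; simp) (by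
        have h1 : dblConjMat (1 : Matrix (Dbl n) (Dbl n) ℂ) = 1 := by
          ext (i | i) (j | j) <;> simp [dblConjMat, Matrix.one_apply, apply_ite]
        rw [sub_eq_add_neg, ← neg_one_smul ℂ, dblConjMat_add, dblConjMat_smul, dblConjMat_mul,
          dblConjMat_flat, hEc, h1]
        simp) (by
        intro h
        have := congrArg Matrix.trace h
        rw [Matrix.trace_sub, Matrix.trace_mul_comm, hE] at this
        simp only [Matrix.trace_one, Matrix.trace_zero, Fintype.card_sum, Fintype.card_fin,
          sub_eq_zero] at this
        have := Nat.cast_injective (R := ℂ) this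
        omega)
    have hperp : flat E *ᵥ g = 0 := by
      rw [← hg, Matrix.mulVec_mulVec, Matrix.mul_sub, ← Matrix.mul_assoc, hE]
      simp
    rw [hEdef, flat_dblColumns_mulVec] at hperp
    have p1 : ∀ i, formJ (e i) g = 0 := fun i => congrFun hperp (Sum.inl i)
    have p2 : ∀ i, formJ (dblConj (e i)) g = 0 := fun i => by
      simpa using congrFun hperp (Sum.inr i)
    have p1' : ∀ i, formJ g (e i) = 0 := fun i => by rw [← formJ_symm, p1, star_zero]
    have p3 : ∀ i, formJ (e i) (dblConj g) = 0 := fun i => by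
      rw [formJ_dblConj_right, p2]; simp
    have p4 : ∀ i, formJ g (dblConj (e i)) = 0 := fun i => by
      rw [← formJ_symm, p2, star_zero]
    refine ⟨Fin.snoc e g, ?_, fun i j => ?_, fun i j => ?_⟩
    · rw [← he0]
      exact Fin.snoc_castSucc (α := fun _ => Dbl n → ℂ) g e 0
    · induction i using Fin.lastCases with
      | last => induction j using Fin.lastCases with
        | last => simp [hg1]
        | cast j => simp [p1', (Fin.castSucc_ne_last j).symm]
      | cast i => induction j using Fin.lastCases with
        | last => simp [p1, Fin.castSucc_ne_last i]
        | cast j => simp [he1]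
    · induction i using Fin.lastCases with
      | last => induction j using Fin.lastCases with
        | last => simp [formJ_self_dblConj]
        | cast j => simp [p4]
      | cast i => induction j using Fin.lastCases with
        | last => simp [p3]
        | cast j => simp [he2]

/-- The complement of a vector of unit length and its conjugate: an isometric doubled-up matrix `E`
whose range consists of the vectors Euclidean-orthogonal to both, so that `E E^♭` fixes every matrix
with columns in this range. -/
theorem exists_complement {n : ℕ} {v : Dbl (n + 1) → ℂ} (hv : formJ v v = 1) :
    ∃ E : Matrix (Dbl (n + 1)) (Dbl n) ℂ, dblConjMat E = E ∧ flat E * E = 1 ∧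
      Eᴴ *ᵥ v = 0 ∧ ∀ {l : ℕ} (M : Matrix (Dbl (n + 1)) (Dbl l) ℂ),
        Mᴴ *ᵥ v = 0 → Mᴴ *ᵥ dblConj v = 0 → E * (flat E * M) = M := by
  -- the frame starts from `J v`, whose orthogonality for the form is Euclidean orthogonality to `v`
  obtain ⟨e, he0, he1, he2⟩ := exists_symplectic_frame (f := matJ (n + 1) *ᵥ v)
    (by rw [formJ_matJ_mulVec_left]; exact hv) n (Nat.lt_succ_self n)
  have hE := flat_dblColumns_mul_self (e := fun j => e j.succ) (fun i j => by simp [he1])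
    (fun i j => he2 _ _)
  -- a left inverse of a square matrix is a right inverse, so the full frame resolves the identity
  have hS := mul_eq_one_comm.1 (flat_dblColumns_mul_self he1 he2)
  refine ⟨dblColumns fun j => e j.succ, dblConjMat_dblColumns _, hE, ?_, fun M h1 h2 => ?_⟩
  · have : flat (dblColumns fun j => e j.succ) *ᵥ e 0 = 0 := by
      rw [flat_dblColumns_mulVec]
      ext (j | j)
      · simp [he1]
      · have := formJ_symm (e 0) (dblConj (e j.succ))
        rw [he2] at this
        simp [← this]
    rw [he0, flat, ← Matrix.mulVec_mulVec, matJ_mulVec_matJ_mulVec, ← Matrix.mulVec_mulVec] at this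
    rw [← matJ_mulVec_matJ_mulVec (_ *ᵥ v), this, Matrix.mulVec_zero]
  · have col : ∀ (w : Dbl (n + 1) → ℂ), Mᴴ *ᵥ w = 0 → ∀ x, star w ⬝ᵥ (M *ᵥ x) = 0 := by
      intro w hw x
      rw [star_dotProduct_mulVec, hw]; simp
    rw [Matrix.ext_iff_mulVec]
    intro y
    rw [← Matrix.mulVec_mulVec, ← Matrix.mulVec_mulVec]
    set x := M *ᵥ y with hx
    have h1' : formJ (e 0) x = 0 := by rw [he0, formJ_matJ_mulVec_left, col v h1]
    have h2' : formJ (dblConj (e 0)) x = 0 := by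
      rw [he0, dblConj_matJ_mulVec, ← Matrix.mulVec_neg, formJ_matJ_mulVec_left, star_neg,
        neg_dotProduct, col _ h2, neg_zero]
    conv_rhs => rw [← Matrix.one_mulVec x, ← hS, ← Matrix.mulVec_mulVec]
    rw [flat_dblColumns_mulVec, flat_dblColumns_mulVec]
    ext i
    simp [Matrix.mulVec, dotProduct, dblColumns, Fin.sum_univ_succ, h1', h2']

/-! ### Physical realizability and the power spectrum -/

theorem flat_sub {k l : ℕ} (M N : Matrix (Dbl k) (Dbl l) ℂ) : flat (M - N) = flat M - flat N := by
  simp [flat, Matrix.mul_sub, Matrix.sub_mul]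

theorem flat_neg {k l : ℕ} (M : Matrix (Dbl k) (Dbl l) ℂ) : flat (-M) = -flat M := by
  simp [flat]

theorem flat_smul {k l : ℕ} (c : ℂ) (M : Matrix (Dbl k) (Dbl l) ℂ) :
    flat (c • M) = star c • flat M := by
  simp [flat]

theorem vacuumCov_mul_matJ (m : ℕ) : vacuumCov m * matJ m = vacuumCov m := by
  simp [vacuumCov, matJ, Matrix.fromBlocks_multiply]

theorem matJ_mul_vacuumCov (m : ℕ) : matJ m * vacuumCov m = vacuumCov m := by
  simp [vacuumCov, matJ, Matrix.fromBlocks_multiply]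

theorem conjTranspose_vacuumCov (m : ℕ) : (vacuumCov m)ᴴ = vacuumCov m := by
  simp [vacuumCov, Matrix.fromBlocks_conjTranspose]

theorem vacuumCov_mulVec_eq_zero {m : ℕ} {x : Dbl m → ℂ} (h : matJ m *ᵥ x = -x) :
    vacuumCov m *ᵥ x = 0 := by
  have h1 : vacuumCov m *ᵥ x = -(vacuumCov m *ᵥ x) := by
    conv_lhs => rw [← vacuumCov_mul_matJ, ← Matrix.mulVec_mulVec, h, Matrix.mulVec_neg]
  exact self_eq_neg.1 h1

theorem matJ_mulVec_eq_neg {m : ℕ} {x : Dbl m → ℂ} (h : vacuumCov m *ᵥ x = 0) :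
    matJ m *ᵥ x = -x := by
  ext (i | i)
  · have := congrFun h (Sum.inl i)
    simp [vacuumCov, Matrix.fromBlocks_mulVec] at this
    simp [matJ_mulVec_inl, this]
  · simp [matJ_mulVec_inr]

theorem vacuumCov_mulVec_eq_self {m : ℕ} {x : Dbl m → ℂ} (h : matJ m *ᵥ x = x) :
    vacuumCov m *ᵥ x = x := by
  ext (i | i)
  · simp [vacuumCov, Matrix.fromBlocks_mulVec]
  · have := congrFun h (Sum.inr i)
    rw [matJ_mulVec_inr] at this
    have h0 := self_eq_neg.1 this.symm
    simp [vacuumCov, Matrix.fromBlocks_mulVec, h0]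

namespace QLS

variable {n m : ℕ} (G : QLS n m)

theorem dblConjMat_C : dblConjMat G.C = G.C := dblConjMat_doubledUp _ _

theorem dblConjMat_Omega : dblConjMat G.Omega = G.Omega := dblConjMat_doubledUp _ _

theorem conjTranspose_Omega : G.Omegaᴴ = G.Omega := by
  have h1 := G.conjTranspose_Omegaminus
  have h2 := G.transpose_Omegaplus
  have h3 : ∀ i j, star (G.Omegaminus j i) = G.Omegaminus i j :=
    fun i j => congrFun (congrFun h1 i) j
  have h4 : ∀ i j, G.Omegaplus j i = G.Omegaplus i j := fun i j => congrFun (congrFun h2 i) j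
  ext (i | i) (j | j)
  · simpa [Omega, doubledUp] using h3 i j
  · simpa [Omega, doubledUp] using h4 i j
  · simpa [Omega, doubledUp] using congrArg star (h4 i j)
  · simpa [Omega, doubledUp] using congrArg star (h3 i j)

/-- Every doubled-up coupling matrix and every doubled-up Hermitian Hamiltonian matrix arise from
a system. -/
theorem exists_of_dblConjMat {C₀ : Matrix (Dbl m) (Dbl n) ℂ} {W : Matrix (Dbl n) (Dbl n) ℂ}
    (hC : dblConjMat C₀ = C₀) (hW : dblConjMat W = W) (hWH : Wᴴ = W) :
    ∃ G : QLS n m, G.C = C₀ ∧ G.Omega = W := by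
  obtain ⟨X, Y, rfl⟩ := exists_eq_doubledUp_iff.2 hC
  obtain ⟨U, Z, rfl⟩ := exists_eq_doubledUp_iff.2 hW
  refine ⟨⟨X, Y, U, Z, ?_, ?_⟩, rfl, rfl⟩
  · ext i j
    simpa [doubledUp] using congrFun (congrFun hWH (Sum.inl i)) (Sum.inl j)
  · ext i j
    simpa [doubledUp] using congrFun (congrFun hWH (Sum.inl i)) (Sum.inr j)

theorem dblConjMat_A : dblConjMat G.A = G.A := by
  rw [A, sub_eq_add_neg, ← neg_smul, ← neg_smul, dblConjMat_add, dblConjMat_smul, dblConjMat_smul,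
    dblConjMat_mul, dblConjMat_mul, dblConjMat_flat, dblConjMat_C, dblConjMat_Omega,
    dblConjMat_matJ]
  simp

/-- The matrix `J C†`; it satisfies `C^♭ = J C† J`. -/
def inputMatrix : Matrix (Dbl n) (Dbl m) ℂ := matJ n * G.Cᴴ

theorem conjTranspose_inputMatrix : G.inputMatrixᴴ = G.C * matJ n := by
  simp [inputMatrix]

theorem inputMatrix_mulVec_dblConj (x : Dbl n → ℂ) :
    G.inputMatrixᴴ *ᵥ dblConj x = -dblConj (G.inputMatrixᴴ *ᵥ x) := by
  have := dblConjMat_mulVec G.inputMatrixᴴ x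
  rw [conjTranspose_inputMatrix, dblConjMat_mul, dblConjMat_C, dblConjMat_matJ,
    Matrix.mul_neg, Matrix.neg_mulVec] at this
  rw [conjTranspose_inputMatrix, ← this, neg_neg]

theorem conjTranspose_A_mulVec_dblConj {x : Dbl n → ℂ} {μ : ℂ} (hA : G.Aᴴ *ᵥ x = μ • x) :
    G.Aᴴ *ᵥ dblConj x = star μ • dblConj x := by
  have := dblConjMat_mulVec G.Aᴴ x
  rwa [dblConjMat_conjTranspose, dblConjMat_A, hA, dblConj_smul] at this

theorem flat_C : flat G.C = G.inputMatrix * matJ m := rfl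

theorem flat_Omega_term : flat (matJ n * G.Omega) = matJ n * G.Omega := by
  simp [flat, conjTranspose_Omega, Matrix.mul_assoc]

/-- Physical realizability: `A + A^♭ + C^♭ C = 0`. -/
theorem A_add_flat_A : G.A + flat G.A + flat G.C * G.C = 0 := by
  have h1 : flat G.A = -((1 / 2 : ℂ) • (flat G.C * G.C)) + Complex.I • (matJ n * G.Omega) := by
    have e1 : flat (flat G.C * G.C) = flat G.C * G.C := by rw [flat_mul, flat_flat]
    have e2 := G.flat_Omega_term
    rw [A, flat_sub, flat_neg, flat_smul, flat_smul, e1, e2]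
    simp
  rw [h1, A]
  module

/-- The indefinite form solves the Lyapunov equation with noise `J`. -/
theorem lyapunov_matJ :
    G.A * matJ n + matJ n * G.Aᴴ + G.inputMatrix * matJ m * G.inputMatrixᴴ = 0 := by
  have h := congrArg (fun M => M * matJ n) G.A_add_flat_A
  simp only [Matrix.add_mul, Matrix.zero_mul] at h
  rw [← h, conjTranspose_inputMatrix, flat_C]
  simp only [flat, Matrix.mul_assoc, matJ_mul_matJ, Matrix.mul_one]

variable {G}

theorem re_neg_of_mulVec (hG : G.IsHurwitz) {x : Dbl n → ℂ} {μ : ℂ} (hx : x ≠ 0)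
    (h : G.A *ᵥ x = μ • x) : μ.re < 0 :=
  hG _ (mem_spectrum_of_mulVec_eq_smul hx h)

theorem re_neg_of_conjTranspose_mulVec (hG : G.IsHurwitz) {x : Dbl n → ℂ} {μ : ℂ} (hx : x ≠ 0)
    (h : G.Aᴴ *ᵥ x = μ • x) : μ.re < 0 := by
  simpa using hG _ (mem_spectrum_conjTranspose.1 (mem_spectrum_of_mulVec_eq_smul hx h))

/-- A stable system is observable: on an unobservable eigenvector `A^♭` would act as `-A`. -/
theorem injective_observabilityMap (hG : G.IsHurwitz) :
    Function.Injective (observabilityMap G.C G.A) := by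
  refine _root_.injective_observabilityMap fun x μ hA hC => ?_
  by_contra hx
  have h := congrArg (fun M => M *ᵥ x) G.A_add_flat_A
  simp only [Matrix.add_mulVec, ← Matrix.mulVec_mulVec, hC, Matrix.mulVec_zero, add_zero,
    Matrix.zero_mulVec, hA, flat] at h
  have h2 := congrArg (fun y => matJ n *ᵥ y) h
  simp only [Matrix.mulVec_add, matJ_mulVec_matJ_mulVec, Matrix.mulVec_zero,
    Matrix.mulVec_smul] at h2
  have hJx : matJ n *ᵥ x ≠ 0 := fun h0 => hx (by
    rw [← matJ_mulVec_matJ_mulVec x, h0, Matrix.mulVec_zero])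
  have h3 := re_neg_of_conjTranspose_mulVec hG (μ := -μ) hJx (by
    rw [neg_smul]; exact eq_neg_of_add_eq_zero_right h2)
  have h4 := re_neg_of_mulVec hG hx hA
  simp at h3
  linarith

variable (G) in
/-- `P` is a stationary covariance of the system driven by vacuum noise: a Hermitian solution of the
Lyapunov equation. Its positivity plays no role and is not required. -/
def IsStationaryCov (P : Matrix (Dbl n) (Dbl n) ℂ) : Prop :=
  Pᴴ = P ∧ G.A * P + P * G.Aᴴ + G.inputMatrix * vacuumCov m * G.inputMatrixᴴ = 0

theorem exists_isStationaryCov (hG : G.IsHurwitz) : ∃ P, G.IsStationaryCov P :=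
  exists_lyapunov_solution hG (by
    simp [Matrix.mul_assoc, conjTranspose_vacuumCov])

variable (G) in
/-- The input matrix of the stable part of the power spectrum. -/
def spectralInput (P : Matrix (Dbl n) (Dbl n) ℂ) : Matrix (Dbl n) (Dbl m) ℂ :=
  P * G.Cᴴ - G.inputMatrix * vacuumCov m

theorem isUnit_of_notMem {s : ℂ} (hs : s ∉ spectrum ℂ G.A) :
    IsUnit (s • (1 : Matrix (Dbl n) (Dbl n) ℂ) - G.A) := by
  have := spectrum.notMem_iff.1 hs
  rwa [Algebra.algebraMap_eq_smul_one] at this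

/-- The additive decomposition of the power spectrum into a stable and an antistable part. -/
theorem powerSpectrum_eq {P : Matrix (Dbl n) (Dbl n) ℂ} (hP : G.IsStationaryCov P) {s : ℂ}
    (hs : s ∉ spectrum ℂ G.A) (hs' : -(starRingEnd ℂ s) ∉ spectrum ℂ G.A) :
    G.powerSpectrum (vacuumCov m) s = vacuumCov m +
      (G.C * (s • (1 : Matrix (Dbl n) (Dbl n) ℂ) - G.A)⁻¹ * G.spectralInput P +
      (G.C * ((-(starRingEnd ℂ s)) • (1 : Matrix (Dbl n) (Dbl n) ℂ) - G.A)⁻¹ *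
        G.spectralInput P)ᴴ) := by
  obtain ⟨hPH, hL⟩ := hP
  have hu := Matrix.nonsing_inv_mul _ ((Matrix.isUnit_iff_isUnit_det _).1 (isUnit_of_notMem hs))
  have hu' := congrArg Matrix.conjTranspose (Matrix.nonsing_inv_mul _
    ((Matrix.isUnit_iff_isUnit_det _).1 (isUnit_of_notMem hs')))
  rw [powerSpectrum, transferFunction, transferFunction, flat_C, spectralInput]
  set S := s • (1 : Matrix (Dbl n) (Dbl n) ℂ) - G.A with hS
  set S' := (-(starRingEnd ℂ s)) • (1 : Matrix (Dbl n) (Dbl n) ℂ) - G.A with hS'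
  set B := G.inputMatrix with hB
  set V := vacuumCov m with hV
  have hJVJ : matJ m * (V * matJ m) = V := by rw [vacuumCov_mul_matJ, matJ_mul_vacuumCov]
  have hSH : S'ᴴ = -s • (1 : Matrix (Dbl n) (Dbl n) ℂ) - G.Aᴴ := by simp [hS']
  rw [Matrix.conjTranspose_mul, Matrix.conjTranspose_one] at hu'
  have hBVB : B * V * Bᴴ = S * P + P * S'ᴴ := by
    rw [eq_neg_of_add_eq_zero_right hL, hSH, hS]
    simp only [Matrix.sub_mul, Matrix.mul_sub, Matrix.smul_mul, Matrix.mul_smul, Matrix.one_mul,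
      Matrix.mul_one, Matrix.mul_neg, neg_smul]
    abel
  have hmid : S⁻¹ * (B * V * Bᴴ) * (S'⁻¹)ᴴ = P * (S'⁻¹)ᴴ + S⁻¹ * P := by
    rw [hBVB, Matrix.mul_add, Matrix.add_mul, ← Matrix.mul_assoc, hu, Matrix.one_mul,
      Matrix.mul_assoc S⁻¹, Matrix.mul_assoc P, hu', Matrix.mul_one]
  have hlast : G.C * S⁻¹ * (B * matJ m) * V * (matJ m * Bᴴ * (S'⁻¹)ᴴ * G.Cᴴ) =
      G.C * (P * (S'⁻¹)ᴴ + S⁻¹ * P) * G.Cᴴ := by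
    rw [← hmid]
    simp only [Matrix.mul_assoc]
    rw [← Matrix.mul_assoc V (matJ m), ← Matrix.mul_assoc (matJ m) (V * matJ m), hJVJ]
  have hf : (1 - G.C * S'⁻¹ * (B * matJ m))ᴴ = 1 - matJ m * Bᴴ * (S'⁻¹)ᴴ * G.Cᴴ := by
    simp only [Matrix.conjTranspose_sub, Matrix.conjTranspose_one, Matrix.conjTranspose_mul,
      conjTranspose_matJ, Matrix.mul_assoc]
  have hg : (G.C * S'⁻¹ * (P * G.Cᴴ - B * V))ᴴ =
      G.C * P * (S'⁻¹)ᴴ * G.Cᴴ - V * Bᴴ * (S'⁻¹)ᴴ * G.Cᴴ := by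
    simp only [Matrix.conjTranspose_sub, Matrix.conjTranspose_mul, hPH, hV,
      conjTranspose_vacuumCov, Matrix.conjTranspose_conjTranspose, Matrix.sub_mul,
      Matrix.mul_assoc]
  have t1 : G.C * S⁻¹ * (B * matJ m) * V = G.C * S⁻¹ * (B * V) := by
    rw [Matrix.mul_assoc _ _ V, Matrix.mul_assoc B, matJ_mul_vacuumCov]
  have t2 : V * (matJ m * Bᴴ * (S'⁻¹)ᴴ * G.Cᴴ) = V * Bᴴ * (S'⁻¹)ᴴ * G.Cᴴ := by
    simp only [← Matrix.mul_assoc]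
    rw [hV, vacuumCov_mul_matJ]
  calc (1 - G.C * S⁻¹ * (B * matJ m)) * V * (1 - G.C * S'⁻¹ * (B * matJ m))ᴴ
      = V - V * (matJ m * Bᴴ * (S'⁻¹)ᴴ * G.Cᴴ) - G.C * S⁻¹ * (B * matJ m) * V +
        G.C * S⁻¹ * (B * matJ m) * V * (matJ m * Bᴴ * (S'⁻¹)ᴴ * G.Cᴴ) := by
        rw [hf, Matrix.sub_mul, Matrix.one_mul, Matrix.mul_sub, Matrix.mul_one, Matrix.sub_mul]
        abel
    _ = _ := by
        rw [hlast, t1, t2, hg]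
        simp only [Matrix.mul_add, Matrix.add_mul, Matrix.mul_sub, Matrix.mul_assoc]
        abel

/-! ### Splitting off a mode in the vacuum state -/

/-- An uncontrollable eigenvector for the spectral input yields a common eigenvector of `A†` which
couples only to the annihilation-type inputs. -/
theorem exists_passive_eigenvector {P : Matrix (Dbl n) (Dbl n) ℂ}
    (hP : G.IsStationaryCov P) {x : Dbl n → ℂ} {μ : ℂ} (hx : x ≠ 0) (hA : G.Aᴴ *ᵥ x = μ • x)
    (hK : (G.spectralInput P)ᴴ *ᵥ x = 0) :
    ∃ (y : Dbl n → ℂ) (ν : ℂ), y ≠ 0 ∧ G.Aᴴ *ᵥ y = ν • y ∧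
      matJ m *ᵥ (G.inputMatrixᴴ *ᵥ y) = G.inputMatrixᴴ *ᵥ y := by
  obtain ⟨hPH, hL⟩ := hP
  have hK' : G.C *ᵥ (P *ᵥ x) = vacuumCov m *ᵥ (G.inputMatrixᴴ *ᵥ x) := by
    rw [spectralInput, Matrix.conjTranspose_sub, Matrix.conjTranspose_mul,
      Matrix.conjTranspose_mul, Matrix.conjTranspose_conjTranspose, hPH, conjTranspose_vacuumCov,
      Matrix.sub_mulVec, sub_eq_zero, ← Matrix.mulVec_mulVec, ← Matrix.mulVec_mulVec] at hK
    exact hK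
  by_cases hy : matJ n *ᵥ (P *ᵥ x) = 0
  · have hPx : P *ᵥ x = 0 := by
      rw [← matJ_mulVec_matJ_mulVec (P *ᵥ x), hy, Matrix.mulVec_zero]
    rw [hPx, Matrix.mulVec_zero] at hK'
    have hJ := matJ_mulVec_eq_neg hK'.symm
    refine ⟨dblConj x, star μ, fun h0 => hx ?_, G.conjTranspose_A_mulVec_dblConj hA, ?_⟩
    · rw [← dblConj_dblConj x, h0, dblConj_zero]
    · rw [inputMatrix_mulVec_dblConj, Matrix.mulVec_neg, ← dblConj_matJ_mulVec, hJ, dblConj_neg]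
  · have hBy : G.inputMatrixᴴ *ᵥ (matJ n *ᵥ (P *ᵥ x)) =
        vacuumCov m *ᵥ (G.inputMatrixᴴ *ᵥ x) := by
      rw [← hK', conjTranspose_inputMatrix, ← Matrix.mulVec_mulVec, matJ_mulVec_matJ_mulVec]
    have hJB : matJ m *ᵥ (G.inputMatrixᴴ *ᵥ (matJ n *ᵥ (P *ᵥ x))) =
        G.inputMatrixᴴ *ᵥ (matJ n *ᵥ (P *ᵥ x)) := by
      rw [hBy, Matrix.mulVec_mulVec, matJ_mul_vacuumCov]
    refine ⟨matJ n *ᵥ (P *ᵥ x), μ, hy, ?_, hJB⟩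
    have h1 := congrArg (fun M => M *ᵥ x) hL
    have h2 := congrArg (fun M => M *ᵥ (matJ n *ᵥ (P *ᵥ x))) G.lyapunov_matJ
    simp only [Matrix.add_mulVec, Matrix.zero_mulVec, ← Matrix.mulVec_mulVec, hA,
      Matrix.mulVec_smul] at h1 h2
    rw [hJB, hBy, matJ_mulVec_matJ_mulVec, ← h1] at h2
    have h3 : matJ n *ᵥ (G.Aᴴ *ᵥ (matJ n *ᵥ (P *ᵥ x))) = μ • (P *ᵥ x) := by
      simpa using h2
    rw [← matJ_mulVec_matJ_mulVec (G.Aᴴ *ᵥ (matJ n *ᵥ (P *ᵥ x))), h3, Matrix.mulVec_smul]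

/-- An eigenvector of `A†` coupling only to the annihilation-type inputs is positive for the
indefinite form, hence can be normalized. -/
theorem exists_normalized_passive_eigenvector (hG : G.IsHurwitz) {y : Dbl n → ℂ} {μ : ℂ}
    (hy : y ≠ 0) (hA : G.Aᴴ *ᵥ y = μ • y)
    (hB : matJ m *ᵥ (G.inputMatrixᴴ *ᵥ y) = G.inputMatrixᴴ *ᵥ y) :
    ∃ v : Dbl n → ℂ, formJ v v = 1 ∧ G.Aᴴ *ᵥ v = μ • v ∧
      matJ m *ᵥ (G.inputMatrixᴴ *ᵥ v) = G.inputMatrixᴴ *ᵥ v := by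
  have hμ := re_neg_of_conjTranspose_mulVec hG hy hA
  have h1 := congrArg (fun M => M *ᵥ y) G.lyapunov_matJ
  simp only [Matrix.add_mulVec, Matrix.zero_mulVec, ← Matrix.mulVec_mulVec, hA,
    Matrix.mulVec_smul, hB] at h1
  have h2 := congrArg (fun w => star y ⬝ᵥ w) h1
  simp only [dotProduct_add, dotProduct_zero, dotProduct_smul] at h2
  rw [star_dotProduct_mulVec G.A, hA, star_dotProduct_mulVec G.inputMatrix,
    star_dotProduct_self, star_smul, smul_dotProduct] at h2
  have hreal : ∃ r : ℝ, formJ y y = r := Complex.conj_eq_iff_real.1 (formJ_symm y y)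
  obtain ⟨r, hr⟩ := hreal
  rw [← formJ, hr] at h2
  have h3 := congrArg Complex.re h2
  simp only [smul_eq_mul, Complex.add_re, Complex.mul_re, Complex.star_def, Complex.conj_re,
    Complex.conj_im, Complex.ofReal_re, Complex.ofReal_im, mul_zero, sub_zero,
    Complex.zero_re] at h3
  have hn : 0 ≤ ∑ i, Complex.normSq ((G.inputMatrixᴴ *ᵥ y) i) :=
    Finset.sum_nonneg fun i _ => Complex.normSq_nonneg _
  have hrpos : 0 < r := by
    rcases lt_trichotomy r 0 with hlt | heq | hgt
    · nlinarith
    · exfalso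
      rw [heq] at h3
      have h0 : ∑ i, Complex.normSq ((G.inputMatrixᴴ *ᵥ y) i) = 0 := by linarith
      have hBy : G.inputMatrixᴴ *ᵥ y = 0 := by
        rw [← star_dotProduct_self_eq_zero_iff, star_dotProduct_self, h0, Complex.ofReal_zero]
      rw [hBy, Matrix.mulVec_zero, add_zero] at h1
      have hJy : matJ n *ᵥ y ≠ 0 := fun h0 => hy (by
        rw [← matJ_mulVec_matJ_mulVec y, h0, Matrix.mulVec_zero])
      have := re_neg_of_mulVec hG (μ := -μ) hJy (by
        rw [neg_smul]; exact eq_neg_of_add_eq_zero_left h1)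
      simp at this
      linarith
    · exact hgt
  obtain ⟨c, hc⟩ := exists_smul_formJ_eq_one hrpos hr
  refine ⟨c • y, hc, ?_, ?_⟩
  · rw [Matrix.mulVec_smul, hA, smul_comm]
  · rw [Matrix.mulVec_smul, Matrix.mulVec_smul, hB]

/-- Along an eigenvector of `A†`, the Lyapunov operator is a shift of `A` by a number with negative
real part, so a solution `X` of the equation kills the eigenvector if the noise does. -/
theorem mulVec_eq_zero_of_lyapunov {G : QLS n m} (hG : G.IsHurwitz)
    {X R : Matrix (Dbl n) (Dbl n) ℂ} (h : G.A * X + X * G.Aᴴ + R = 0) {x : Dbl n → ℂ} {μ : ℂ}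
    (hA : G.Aᴴ *ᵥ x = μ • x) (hR : R *ᵥ x = 0) : X *ᵥ x = 0 := by
  by_contra hx
  have h1 := congrArg (fun M => M *ᵥ x) h
  simp only [Matrix.add_mulVec, Matrix.zero_mulVec, ← Matrix.mulVec_mulVec, hA,
    Matrix.mulVec_smul, hR, add_zero] at h1
  have h2 := re_neg_of_mulVec hG (μ := -μ) hx (by
    rw [neg_smul]; exact eq_neg_of_add_eq_zero_left h1)
  have h3 := re_neg_of_conjTranspose_mulVec hG (fun h0 => hx (by rw [h0, Matrix.mulVec_zero])) hA
  simp at h2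
  linarith

/-- A mode coupling only to the annihilation-type inputs stays in the vacuum state, and can be split
off without changing the power spectrum. The smaller system is the compression of `G` to the
`A`-invariant complement of the mode. -/
theorem exists_reduction {G : QLS (n + 1) m} (hG : G.IsHurwitz) {v : Dbl (n + 1) → ℂ} {μ : ℂ}
    (hv : formJ v v = 1) (hA : G.Aᴴ *ᵥ v = μ • v)
    (hB : matJ m *ᵥ (G.inputMatrixᴴ *ᵥ v) = G.inputMatrixᴴ *ᵥ v) :
    ∃ G₀ : QLS n m, G₀.IsHurwitz ∧ SamePowerSpectrum (vacuumCov m) G₀ G := by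
  obtain ⟨P, hP⟩ := exists_isStationaryCov hG
  obtain ⟨hPH, hL⟩ := id hP
  have hA' := G.conjTranspose_A_mulVec_dblConj hA
  have hVB : vacuumCov m *ᵥ (G.inputMatrixᴴ *ᵥ v) = G.inputMatrixᴴ *ᵥ v :=
    vacuumCov_mulVec_eq_self hB
  have hVB' : vacuumCov m *ᵥ (G.inputMatrixᴴ *ᵥ dblConj v) = 0 := by
    refine vacuumCov_mulVec_eq_zero ?_
    rw [inputMatrix_mulVec_dblConj, Matrix.mulVec_neg, ← dblConj_matJ_mulVec, hB, neg_neg]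
  -- the mode is in the vacuum state
  have hPv : P *ᵥ v = matJ (n + 1) *ᵥ v := by
    have hd : G.A * (P - matJ (n + 1)) + (P - matJ (n + 1)) * G.Aᴴ +
        (G.inputMatrix * vacuumCov m * G.inputMatrixᴴ -
          G.inputMatrix * matJ m * G.inputMatrixᴴ) = 0 := by
      rw [← sub_eq_zero.2 (hL.trans G.lyapunov_matJ.symm), Matrix.mul_sub, Matrix.sub_mul]
      abel
    have := mulVec_eq_zero_of_lyapunov hG hd hA (by
      rw [Matrix.sub_mulVec]
      simp only [← Matrix.mulVec_mulVec]
      rw [hVB, hB, sub_self])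
    rwa [Matrix.sub_mulVec, sub_eq_zero] at this
  have hPw : P *ᵥ dblConj v = 0 := mulVec_eq_zero_of_lyapunov hG hL hA' (by
    simp only [← Matrix.mulVec_mulVec]
    rw [hVB', Matrix.mulVec_zero])
  obtain ⟨E, hEc, hE, hEv, hcompl⟩ := exists_complement hv
  have hEw : Eᴴ *ᵥ dblConj v = 0 := by
    have := dblConjMat_mulVec Eᴴ v
    rwa [dblConjMat_conjTranspose, hEc, hEv, dblConj_zero] at this
  obtain ⟨G₀, hC₀, hW₀⟩ := exists_of_dblConjMat (C₀ := G.C * E) (W := Eᴴ * G.Omega * E)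
    (by rw [dblConjMat_mul, dblConjMat_C, hEc])
    (by rw [dblConjMat_mul, dblConjMat_mul, dblConjMat_conjTranspose, dblConjMat_Omega, hEc])
    (by simp [conjTranspose_Omega, Matrix.mul_assoc])
  have hA₀ : G₀.A = flat E * (G.A * E) := by
    rw [A, hC₀, hW₀, A, flat_mul]
    simp only [Matrix.sub_mul, Matrix.mul_sub, Matrix.neg_mul, Matrix.mul_neg, Matrix.smul_mul,
      Matrix.mul_smul, Matrix.mul_assoc, flat, matJ_mul_matJ_mul]
  have hAE : G.A * E = E * G₀.A := by
    rw [hA₀]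
    refine (hcompl _ ?_ ?_).symm
    · rw [Matrix.conjTranspose_mul, ← Matrix.mulVec_mulVec, hA, Matrix.mulVec_smul, hEv, smul_zero]
    · rw [Matrix.conjTranspose_mul, ← Matrix.mulVec_mulVec, hA', Matrix.mulVec_smul, hEw, smul_zero]
  have hB₀ : G₀.inputMatrix = flat E * G.inputMatrix := by
    simp [inputMatrix, hC₀, flat, Matrix.mul_assoc]
  have hEP : E * (flat E * (P * (flat E)ᴴ)) = P * (flat E)ᴴ := by
    refine hcompl _ ?_ ?_
    · rw [Matrix.conjTranspose_mul, Matrix.conjTranspose_conjTranspose, hPH,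
        ← Matrix.mulVec_mulVec, hPv, flat, ← Matrix.mulVec_mulVec, matJ_mulVec_matJ_mulVec,
        ← Matrix.mulVec_mulVec, hEv, Matrix.mulVec_zero]
    · rw [Matrix.conjTranspose_mul, Matrix.conjTranspose_conjTranspose, hPH,
        ← Matrix.mulVec_mulVec, hPw, Matrix.mulVec_zero]
  -- the compressed covariance is stationary for the compressed system
  set P₀ := flat E * (P * (flat E)ᴴ) with hP₀
  have hP₀H : P₀ᴴ = P₀ := by simp [hP₀, hPH, Matrix.mul_assoc]
  have hPE : P₀ * Eᴴ = flat E * P := by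
    have := congrArg Matrix.conjTranspose hEP
    rwa [Matrix.conjTranspose_mul, hP₀H, Matrix.conjTranspose_mul, hPH,
      Matrix.conjTranspose_conjTranspose] at this
  have hAP : G₀.A * P₀ = flat E * (G.A * P) * (flat E)ᴴ := by
    rw [hA₀, Matrix.mul_assoc, Matrix.mul_assoc G.A, hEP]
    simp only [Matrix.mul_assoc]
  have hPst : G₀.IsStationaryCov P₀ := by
    refine ⟨hP₀H, ?_⟩
    have hPA : P₀ * G₀.Aᴴ = flat E * (P * G.Aᴴ) * (flat E)ᴴ := by
      have := congrArg Matrix.conjTranspose hAP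
      simpa [hP₀H, hPH, Matrix.mul_assoc] using this
    have := congrArg (fun M => flat E * M * (flat E)ᴴ) hL
    simp only [Matrix.mul_add, Matrix.add_mul, Matrix.mul_zero, Matrix.zero_mul] at this
    rw [hAP, hPA, hB₀, ← this, Matrix.conjTranspose_mul]
    simp only [Matrix.mul_assoc]
  have hK₀ : G₀.spectralInput P₀ = flat E * G.spectralInput P := by
    rw [spectralInput, spectralInput, hC₀, Matrix.conjTranspose_mul, ← Matrix.mul_assoc, hPE, hB₀,
      Matrix.mul_sub, Matrix.mul_assoc, Matrix.mul_assoc]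
  have hEK : E * G₀.spectralInput P₀ = G.spectralInput P := by
    -- the spectral input does not reach the split-off mode
    have hKH : (G.spectralInput P)ᴴ = G.C * P - vacuumCov m * G.inputMatrixᴴ := by
      simp [spectralInput, hPH, conjTranspose_vacuumCov]
    rw [hK₀]
    refine hcompl _ ?_ ?_
    · rw [hKH, Matrix.sub_mulVec, ← Matrix.mulVec_mulVec, ← Matrix.mulVec_mulVec, hVB, hPv,
        conjTranspose_inputMatrix, ← Matrix.mulVec_mulVec, sub_self]
    · rw [hKH, Matrix.sub_mulVec, ← Matrix.mulVec_mulVec, ← Matrix.mulVec_mulVec, hVB', hPw,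
        Matrix.mulVec_zero, sub_zero]
  refine ⟨G₀, fun ν hν => ?_, fun s h0 h0' h1 h1' => ?_⟩
  · obtain ⟨x, hx, hAx⟩ := exists_mulVec_eq_smul_of_mem_spectrum hν
    refine re_neg_of_mulVec hG (x := E *ᵥ x) (fun h => hx ?_) ?_
    · rw [← Matrix.one_mulVec x, ← hE, ← Matrix.mulVec_mulVec, h, Matrix.mulVec_zero]
    · rw [Matrix.mulVec_mulVec, hAE, ← Matrix.mulVec_mulVec, hAx, Matrix.mulVec_smul]
  · have key : ∀ z : ℂ, z ∉ spectrum ℂ G₀.A → z ∉ spectrum ℂ G.A →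
        G₀.C * (z • (1 : Matrix (Dbl n) (Dbl n) ℂ) - G₀.A)⁻¹ * G₀.spectralInput P₀ =
        G.C * (z • (1 : Matrix (Dbl (n + 1)) (Dbl (n + 1)) ℂ) - G.A)⁻¹ * G.spectralInput P := by
      intro z hz hz'
      rw [hC₀, ← hEK, Matrix.mul_assoc G.C E, ← inv_mul_eq_mul_inv_of_intertwine hAE
        (isUnit_of_notMem hz') (isUnit_of_notMem hz)]
      simp only [Matrix.mul_assoc]
    rw [powerSpectrum_eq hPst h0 h0', powerSpectrum_eq hP h1 h1', key s h0 h1, key _ h0' h1']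

/-- For a globally minimal system, the stable part of the power spectrum is a controllable
realization. -/
theorem controllableSubspace_spectralInput {G : QLS n m} (hG : G.IsHurwitz)
    (hmin : IsGloballyMinimal (vacuumCov m) G) {P : Matrix (Dbl n) (Dbl n) ℂ}
    (hP : G.IsStationaryCov P) : controllableSubspace G.A (G.spectralInput P) = ⊤ := by
  refine controllableSubspace_eq_top fun x μ hA hK => ?_
  by_contra hx
  cases n with
  | zero => exact hx (Subsingleton.elim _ _)
  | succ n =>
    obtain ⟨y, ν, hy, hAy, hBy⟩ := exists_passive_eigenvector hP hx hA hK
    obtain ⟨v, hv, hAv, hBv⟩ := exists_normalized_passive_eigenvector hG hy hAy hBy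
    obtain ⟨G₀, hG₀, hsame⟩ := exists_reduction hG hv hAv hBv
    exact hmin n (Nat.lt_succ_self n) G₀ hG₀ hsame

/-! ### Symplectic similarity -/

/-- Equality of power spectra makes two globally minimal systems similar, and the similarity is
automatically symplectic: it preserves `J` by uniqueness for the Lyapunov equation, and it is
doubled-up because the similarity of observable systems is unique. -/
theorem SamePowerSpectrum.symplecticallySimilar {n₁ n₂ : ℕ} {G₁ : QLS n₁ m} {G₂ : QLS n₂ m}
    (h : SamePowerSpectrum (vacuumCov m) G₁ G₂) (hG₁ : G₁.IsHurwitz) (hG₂ : G₂.IsHurwitz)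
    (hmin₁ : IsGloballyMinimal (vacuumCov m) G₁) (hmin₂ : IsGloballyMinimal (vacuumCov m) G₂) :
    SymplecticallySimilar G₁ G₂ := by
  obtain ⟨P₁, hP₁⟩ := exists_isStationaryCov hG₁
  obtain ⟨P₂, hP₂⟩ := exists_isStationaryCov hG₂
  have hmom := moments_eq_of_paraHermitian_eq hG₁ hG₂ G₁.C (G₁.spectralInput P₁) G₂.C
    (G₂.spectralInput P₂) (by
      -- both defining formulas make sense for all large `s`
      have ev : ∀ {k : ℕ} (G : QLS k m), ∀ᶠ s in Bornology.cobounded ℂ,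
          s ∉ spectrum ℂ G.A ∧ -(starRingEnd ℂ s) ∉ spectrum ℂ G.A := by
        intro k G
        have hb : Bornology.IsBounded (spectrum ℂ G.A) := (Matrix.finite_spectrum G.A).isBounded
        obtain ⟨r, hr⟩ := hb.exists_norm_le
        filter_upwards [Filter.tendsto_atTop.1 (tendsto_norm_cobounded_atTop (E := ℂ)) (r + 1)]
          with s hs
        refine ⟨fun hmem => ?_, fun hmem => ?_⟩
        · linarith [hr _ hmem]
        · have := hr _ hmem
          rw [norm_neg, RCLike.norm_conj] at this
          linarith
      filter_upwards [ev G₁, ev G₂] with s h1 h2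
      have := h s h1.1 h1.2 h2.1 h2.2
      rwa [powerSpectrum_eq hP₁ h1.1 h1.2, powerSpectrum_eq hP₂ h2.1 h2.2, add_right_inj] at this)
  have ho₂ := injective_observabilityMap hG₂
  obtain ⟨hcard, T, hCT, hTA⟩ := exists_similarity (injective_observabilityMap hG₁) ho₂
    (controllableSubspace_spectralInput hG₁ hmin₁ hP₁)
    (controllableSubspace_spectralInput hG₂ hmin₂ hP₂) hmom
  have hn : n₁ = n₂ := by
    simp only [Fintype.card_sum, Fintype.card_fin] at hcard
    omega
  have hreal : ∀ {k : ℕ} (G : QLS k m),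
      matJ k * G.A + G.Aᴴ * matJ k + G.Cᴴ * (matJ m * G.C) = 0 := by
    intro k G
    have := congrArg (fun M => matJ k * M) G.A_add_flat_A
    simpa [Matrix.mul_add, flat, Matrix.mul_assoc] using this
  have hTJT : Tᴴ * matJ n₂ * T = matJ n₁ := by
    rw [← sub_eq_zero]
    refine eq_zero_of_lyapunov_conjTranspose hG₁ ?_
    have h2 := congrArg (fun M => Tᴴ * M * T) (hreal G₂)
    have hTA' := congrArg Matrix.conjTranspose hTA
    rw [Matrix.conjTranspose_mul, Matrix.conjTranspose_mul] at hTA'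
    have e1 : Tᴴ * matJ n₂ * T * G₁.A = Tᴴ * (matJ n₂ * G₂.A) * T := by
      rw [Matrix.mul_assoc _ T, hTA]; simp only [Matrix.mul_assoc]
    have e2 : G₁.Aᴴ * (Tᴴ * matJ n₂ * T) = Tᴴ * (G₂.Aᴴ * matJ n₂) * T := by
      rw [← Matrix.mul_assoc, ← Matrix.mul_assoc, hTA']; simp only [Matrix.mul_assoc]
    have e3 : Tᴴ * (G₂.Cᴴ * (matJ m * G₂.C)) * T = G₁.Cᴴ * (matJ m * G₁.C) := by
      rw [← hCT, Matrix.conjTranspose_mul]; simp only [Matrix.mul_assoc]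
    simp only [Matrix.mul_add, Matrix.add_mul, Matrix.mul_zero, Matrix.zero_mul, e3] at h2
    rw [Matrix.sub_mul, Matrix.mul_sub, e1, e2, ← sub_eq_zero.2 (h2.trans (hreal G₁).symm)]
    abel
  have hflat : flat T * T = 1 := by
    rw [flat, Matrix.mul_assoc, Matrix.mul_assoc, ← Matrix.mul_assoc Tᴴ, hTJT, matJ_mul_matJ]
  have hflat' : T * flat T = 1 :=
    (Matrix.mul_eq_one_comm_of_card_eq _ _ _ hcard).1 hflat
  have hdbl : dblConjMat T = T := by
    refine similarity_unique ho₂ ?_ ?_ hCT hTA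
    · rw [← dblConjMat_C, ← dblConjMat_mul, hCT, dblConjMat_C]
    · have := congrArg dblConjMat hTA
      rwa [dblConjMat_mul, dblConjMat_mul, dblConjMat_A, dblConjMat_A] at this
  refine ⟨hn, T, ⟨hflat, hflat', exists_eq_doubledUp_iff.2 hdbl⟩, ?_, ?_⟩
  · rw [hTA, Matrix.mul_assoc, hflat', Matrix.mul_one]
  · rw [← hCT, Matrix.mul_assoc, hflat', Matrix.mul_one]

theorem SymplecticallySimilar.sameTransferFunction {n₁ n₂ : ℕ} {G₁ : QLS n₁ m} {G₂ : QLS n₂ m}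
    (h : SymplecticallySimilar G₁ G₂) : SameTransferFunction G₁ G₂ := by
  obtain ⟨-, T, ⟨hT, -, -⟩, hA, hC⟩ := h
  intro s h1 h2
  have hAT : G₂.A * T = T * G₁.A := by rw [hA, Matrix.mul_assoc, hT, Matrix.mul_one]
  have hinv := inv_mul_eq_mul_inv_of_intertwine hAT (isUnit_of_notMem h2) (isUnit_of_notMem h1)
  have hmid : flat T * (s • (1 : Matrix (Dbl n₂) (Dbl n₂) ℂ) - G₂.A)⁻¹ * T =
      (s • (1 : Matrix (Dbl n₁) (Dbl n₁) ℂ) - G₁.A)⁻¹ := by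
    rw [Matrix.mul_assoc, hinv, ← Matrix.mul_assoc, hT, Matrix.one_mul]
  rw [transferFunction, transferFunction, ← hmid, hC, flat_mul, flat_flat]
  simp only [Matrix.mul_assoc]

theorem SameTransferFunction.samePowerSpectrum {n₁ n₂ : ℕ} {G₁ : QLS n₁ m} {G₂ : QLS n₂ m}
    (h : SameTransferFunction G₁ G₂) (V : Matrix (Dbl m) (Dbl m) ℂ) :
    SamePowerSpectrum V G₁ G₂ := by
  intro s h1 h1' h2 h2'
  rw [powerSpectrum, powerSpectrum, h s h1 h2, h _ h1' h2']

end QLS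

theorem theorem3 {n₁ n₂ m : ℕ} (G₁ : QLS n₁ m) (G₂ : QLS n₂ m)
    (hstable₁ : G₁.IsHurwitz) (hstable₂ : G₂.IsHurwitz)
    (hmin₁ : QLS.IsGloballyMinimal (vacuumCov m) G₁)
    (hmin₂ : QLS.IsGloballyMinimal (vacuumCov m) G₂) :
    (QLS.SamePowerSpectrum (vacuumCov m) G₁ G₂ ↔ QLS.SameTransferFunction G₁ G₂) ∧
    (QLS.SamePowerSpectrum (vacuumCov m) G₁ G₂ ↔ QLS.SymplecticallySimilar G₁ G₂) ∧
    (QLS.SameTransferFunction G₁ G₂ ↔ QLS.SymplecticallySimilar G₁ G₂) := by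
  have h1 : QLS.SamePowerSpectrum (vacuumCov m) G₁ G₂ → QLS.SymplecticallySimilar G₁ G₂ :=
    fun h => h.symplecticallySimilar hstable₁ hstable₂ hmin₁ hmin₂
  have h2 : QLS.SymplecticallySimilar G₁ G₂ → QLS.SameTransferFunction G₁ G₂ :=
    fun h => h.sameTransferFunction
  have h3 : QLS.SameTransferFunction G₁ G₂ → QLS.SamePowerSpectrum (vacuumCov m) G₁ G₂ :=
    fun h => h.samePowerSpectrum _
  exact ⟨⟨h2 ∘ h1, h3⟩, ⟨h1, h3 ∘ h2⟩, ⟨h1 ∘ h3, h2⟩⟩
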